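/- **Setting.** Let $\iota>0$, $\eta_3,\eta_4>2+2\iota$, $\eta_2=\min(\eta_3,\eta_4)$ with $\iota<(1-1/\eta_2)/4$, and let $K_0,C_6',R>0$. Let $d\ge 1$ and let $d_1,\dots,d_d\ge C_6'$ satisfy $\sum_{i=1}^d 1/d_i=K_0$. Write $L_+(\eta,\sigma)$ for the law on $(0,\infty)$ with survival function $t\mapsto 1/(1+(\sigma t)^{\eta})$, $t>0$. *Inputs.* For two independent trials $k=1,2$ and each coordinate $i=1,\dots,d$, let $\widetilde X_{k,0,i}\sim L_+(\eta_3,d_i)$ and, for $t\ge 1$, $$\widetilde X_{k,t,i}=\begin{cases}2^{1/\eta_3}\,\widetilde X_{k,t-1,i}&\text{with probability }1/2,\\ \min\bigl(2^{1/\eta_3}\,\widetilde X_{k,t-1,i},\ \delta_{k,t,i}\bigr)&\text{with probability }1/2,\end{cases}\qquad \delta_{k,t,i}\sim L_+(\eta_3,d_i),$$ where the starting values, the innovations $\delta_{k,t,i}$, the fair coins deciding between the two cases (one for each $k,t,i$), and a sequence $(U_t)_{t\ge 0}$ of uniform variables on $[0,1]$ are mutually independent. Put $X_{t,i}=\widetilde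 X_{1,t,i}\mathbf 1(U_t\le 1/2)-\widetilde X_{2,t,i}\mathbf 1(U_t>1/2)$ and $X_t=(X_{t,1},\dots,X_{t,d})$, and let $\pi$ be the law of $X_1$ (the process is started from its stationary law). *Responses.* $Y_t=\langle\theta^*,X_t\rangle+\upsilon_t$, where $\|\theta^*\|_1\le R$ and $(\upsilon_t)$ is an i.i.d. sequence of mean-zero variables, independent of $(X_t)$, with $\mathbb P(|\upsilon_t|\ge x)\le 1/(1+x^{\eta_4})$ for all $x>0$. *Estimator.* $\mathcal F_R=\{\langle\theta,\cdot\rangle:\theta\in\mathbb R^d,\ \|\theta\|_1\le R\}$ and $\mathcal H_R=\mathcal F_R-\mathcal F_R$. Let $\|h\|_{L_2}=(\int h^2\,d\pi)^{1/2}$ and $Q_{\mathcal H_R}(u)=\inf_{h\in\mathcal H_R}\pi(|h|\ge u\|h\|_{L_2})$. Let $f^*\in\mathcal F_R$ be a minimizer of the population risk $\mathbb E(f(X_1)-Y_1)^2$ over $\mathcal F_R$ and let $\hat f\in\mathcal F_R$ be a minimizer of the empirical risk $\frac1N\sum_{t=1}^N(f(X_t)-Y_t)^2$ over $\mathcal F_R$.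 **Claim.** The functional $\langle\theta^*,\cdot\rangle$ is a minimizer of the population risk over $\mathcal F_R$, and there is a $\tau>0$ with $Q_{\mathcal H_R}(2\tau)>0$. Moreover, there are positive constants $C_9,\widetilde C_1$ depending only on $\iota,\eta_3,\eta_4,K_0,C_6'$, and a positive constant $\widetilde C_2$ depending only on these parameters and on $R$, such that for all $\tau>0$ with $Q_{\mathcal H_R}(2\tau)>0$, all $0<\tau_0<\tau^2Q_{\mathcal H_R}(2\tau)/8$, all integers $N\ge 1$, and all choices of minimizers $f^*$ and $\hat f$ as above, $$\|\hat f-f^*\|_{L_2}\le\max\left\{N^{-\frac14\left(1-\frac1{\eta_2}\right)+\iota},\ \frac{C_9R}{\tau\,Q_{\mathcal H_R}(2\tau)^{3/2}}\,d^{\,1/(\eta_2-0.5\iota)+\iota/8}\,N^{-1/2+\iota}\right\}$$ with probability at least $$1-\widetilde C_1N^{1-2\iota}Q_{\mathcal H_R}(2\tau)\exp\left(-N^{2\iota}\right)-\widetilde C_2\,\tau_0^{-\frac{2\eta_2}{1+\eta_2}}N^{-\frac{4\iota\eta_2}{1+\eta_2}}.$$ -/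

import Mathlib

open MeasureTheory ProbabilityTheory
open scoped Pointwise

noncomputable section

namespace ParetoRegression

/-! ### The input process -/

/-- Indices of the independent sources of randomness that drive the input process in dimension `d`:
for each of the two trials `k` and each coordinate `i`, a starting value, Pareto innovations and
fair coins; and one uniform variable for each time. -/
inductive Source (d : ℕ) : Type
  | start (k : Fin 2) (i : Fin d)
  | innov (k : Fin 2) (t : ℕ) (i : Fin d)
  | coin (k : Fin 2) (t : ℕ) (i : Fin d)
  | unif (t : ℕ)

/-- `V` has the one-sided Pareto law with tail index `η` and parameter `σ`:
`P(V > t) = 1 / (1 + (σ t) ^ η)` for all `t > 0`. -/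
def HasParetoLaw {Ω : Type*} [MeasurableSpace Ω] (μ : Measure Ω) (V : Ω → ℝ) (η σ : ℝ) : Prop :=
  ∀ t : ℝ, 0 < t → μ {ω | t < V ω} = ENNReal.ofReal (1 / (1 + (σ * t) ^ η))

/-- The joint law of the sources: mutually independent; starting values and innovations of the
`i`-th coordinate are Pareto with parameters `η` and `s i`; coins are fair (values `0` and `1`);
the remaining variables are uniform on `[0, 1]`. -/
structure IsParetoSource {Ω : Type*} [MeasurableSpace Ω] (μ : Measure Ω) {d : ℕ}
    (η : ℝ) (s : Fin d → ℝ) (W : Source d → Ω → ℝ) : Prop where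
  measurable : ∀ j, Measurable (W j)
  indep : iIndepFun W μ
  start_law : ∀ k i, HasParetoLaw μ (W (.start k i)) η (s i)
  innov_law : ∀ k t i, HasParetoLaw μ (W (.innov k t i)) η (s i)
  coin_one : ∀ k t i, μ {ω | W (.coin k t i) ω = 1} = 1 / 2
  coin_zero : ∀ k t i, μ {ω | W (.coin k t i) ω = 0} = 1 / 2
  unif_law : ∀ t, μ.map (W (.unif t)) = volume.restrict (Set.Icc 0 1)

/-- The scalar autoregressive minification recursion: multiply the previous value by `2 ^ (1 / η)`;
if the coin does not show `1`, take the minimum with the innovation. -/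
def trial (η x₀ : ℝ) (coin innov : ℕ → ℝ) : ℕ → ℝ
  | 0 => x₀
  | t + 1 =>
    if coin (t + 1) = 1 then (2 : ℝ) ^ (1 / η) * trial η x₀ coin innov t
    else min ((2 : ℝ) ^ (1 / η) * trial η x₀ coin innov t) (innov (t + 1))

/-- The `i`-th coordinate of the `k`-th trial at time `t`. -/
def trialCoord {Ω : Type*} {d : ℕ} (η : ℝ) (W : Source d → Ω → ℝ) (k : Fin 2) (t : ℕ) (i : Fin d)
    (ω : Ω) : ℝ :=
  trial η (W (.start k i) ω) (fun u => W (.coin k u i) ω) (fun u => W (.innov k u i) ω) t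

/-- The symmetrized input vector at time `t`: the first trial if the uniform variable of time `t` is
at most `1/2`, and minus the second trial otherwise. -/
def input {Ω : Type*} {d : ℕ} (η : ℝ) (W : Source d → Ω → ℝ) (t : ℕ) (ω : Ω) : Fin d → ℝ :=
  fun i => if W (.unif t) ω ≤ 1 / 2 then trialCoord η W 0 t i ω else -trialCoord η W 1 t i ω

/-! ### The noise and the responses -/

/-- I.i.d. centred noise with polynomial tails of index `η`, independent of the process `X`. -/
structure IsPolynomialNoise {Ω : Type*} [MeasurableSpace Ω] (μ : Measure Ω) {d : ℕ}
    (η : ℝ) (X : ℕ → Ω → Fin d → ℝ) (υ : ℕ → Ω → ℝ) : Prop where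
  measurable : ∀ t, Measurable (υ t)
  indep : iIndepFun υ μ
  identDistrib : ∀ t t', IdentDistrib (υ t) (υ t') μ μ
  indep_input : IndepFun (fun ω t => υ t ω) (fun ω t => X t ω) μ
  mean_zero : ∀ t, ∫ ω, υ t ω ∂μ = 0
  tail : ∀ t, ∀ x : ℝ, 0 < x → μ {ω | x ≤ |υ t ω|} ≤ ENNReal.ofReal (1 / (1 + x ^ η))

/-- The responses `Y t = ⟨θ, X t⟩ + υ t`. -/
def response {Ω : Type*} {d : ℕ} (X : ℕ → Ω → Fin d → ℝ) (υ : ℕ → Ω → ℝ) (θ : Fin d → ℝ)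
    (t : ℕ) (ω : Ω) : ℝ :=
  ∑ i, θ i * X t ω i + υ t ω

/-! ### Empirical risk minimization -/

/-- The `ℓ¹`-ball of radius `R`. -/
def l1Ball (d : ℕ) (R : ℝ) : Set (Fin d → ℝ) := {θ | ∑ i, |θ i| ≤ R}

/-- The linear functional `⟨θ, ·⟩`. -/
def linearFun {d : ℕ} (θ : Fin d → ℝ) : (Fin d → ℝ) → ℝ := fun x => ∑ i, θ i * x i

/-- The class of linear functionals with coefficients in the `ℓ¹`-ball of radius `R`. -/
def linearClass (d : ℕ) (R : ℝ) : Set ((Fin d → ℝ) → ℝ) := linearFun '' l1Ball d R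

/-- The `L²(π)` norm of a function. -/
def l2Norm {d : ℕ} (π : Measure (Fin d → ℝ)) (h : (Fin d → ℝ) → ℝ) : ℝ :=
  Real.sqrt (∫ x, h x ^ 2 ∂π)

/-- The small-ball function `Q_H(u) = inf_{h ∈ H} π (|h| ≥ u ‖h‖_{L²(π)})`. -/
def smallBall {d : ℕ} (π : Measure (Fin d → ℝ)) (H : Set ((Fin d → ℝ) → ℝ)) (u : ℝ) : ℝ :=
  sInf ((fun h => π.real {x | u * l2Norm π h ≤ |h x|}) '' H)

/-- `f` minimizes the population risk with squared loss over the class `F`. -/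
def IsPopulationRiskMinimizer {Ω : Type*} [MeasurableSpace Ω] (μ : Measure Ω) {d : ℕ}
    (F : Set ((Fin d → ℝ) → ℝ)) (X : Ω → Fin d → ℝ) (Y : Ω → ℝ) (f : (Fin d → ℝ) → ℝ) : Prop :=
  f ∈ F ∧ ∀ g ∈ F, ∫ ω, (f (X ω) - Y ω) ^ 2 ∂μ ≤ ∫ ω, (g (X ω) - Y ω) ^ 2 ∂μ

/-- `f` minimizes over the class `F` the empirical risk with squared loss of the sample
`(x 1, y 1), …, (x N, y N)`. -/
def IsEmpiricalRiskMinimizer {d : ℕ} (F : Set ((Fin d → ℝ) → ℝ)) (N : ℕ)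
    (x : ℕ → Fin d → ℝ) (y : ℕ → ℝ) (f : (Fin d → ℝ) → ℝ) : Prop :=
  f ∈ F ∧ ∀ g ∈ F, (1 / (N : ℝ)) * ∑ t ∈ Finset.Icc 1 N, (f (x t) - y t) ^ 2 ≤
    (1 / (N : ℝ)) * ∑ t ∈ Finset.Icc 1 N, (g (x t) - y t) ^ 2

/-! ### The rate and the failure probability -/

/-- The rate: `max {N ^ (-(1 - 1/η₂)/4 + ι), C₉ R / (τ Q^(3/2)) d ^ (1/(η₂ - ι/2) + ι/8) N ^ (-1/2 + ι)}`. -/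
def rate (C₉ ι η₂ R τ Q : ℝ) (d N : ℕ) : ℝ :=
  max ((N : ℝ) ^ (-(1 / 4 : ℝ) * (1 - 1 / η₂) + ι))
    (C₉ * R / (τ * Q ^ (3 / 2 : ℝ)) * (d : ℝ) ^ (1 / (η₂ - ι / 2) + ι / 8) *
      (N : ℝ) ^ (-(1 / 2 : ℝ) + ι))

/-- The failure probability:
`C₁ N^(1-2ι) Q exp(-N^(2ι)) + C₂ τ₀^(-2η₂/(1+η₂)) N^(-4ιη₂/(1+η₂))`. -/
def failureProb (C₁ C₂ ι η₂ τ₀ Q : ℝ) (N : ℕ) : ℝ :=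
  C₁ * (N : ℝ) ^ (1 - 2 * ι) * Q * Real.exp (-(N : ℝ) ^ (2 * ι)) +
    C₂ * τ₀ ^ (-(2 * η₂ / (1 + η₂))) * (N : ℝ) ^ (-(4 * ι * η₂ / (1 + η₂)))

end ParetoRegression

end

namespace ParetoRegression

/-! The proof is a small-ball argument. Let `δ` be the difference between the empirical minimizer's
coefficients and the true ones. The basic inequality of least squares
(`IsEmpiricalRiskMinimizer.sum_sq_le`) bounds `∑ ⟨δ, X t⟩ ^ 2` by `4 R` times the largest coordinate
of the multiplier sum `∑ υ t • X t`. It remains to bound this maximum from above and the quadratic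
sum from below.

Upper bound. The noise is centred, independent in time and independent of the input, so the second
moment of each coordinate of the multiplier sum is additive in time, however dependent the inputs
are. Chebyshev and a union bound cost only `∑ 1 / s i ^ 2 ≤ K₀ / C₆`, which is free of the
dimension.

Lower bound. The dependence of the inputs is removed by coupling. The recursion depends on its
starting value only through a minimum (`trial_eq_min`), so a chain restarted `a` steps earlier from
a suitably small constant agrees with the true chain except with probability of order `d * 2 ^ (-a /
2)` (`exists_restarted_ne_le`). Restarted inputs on disjoint windows are independent. Chernoff's
bound therefore counts the windows where `|⟨θ, X⟩|` is at least `2 τ ‖θ‖`, simultaneously for all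
`θ` in a net of the `ℓ¹` ball. The count passes from the net to the whole ball because the `ℓ¹` norm
of the input has a dimension-free second moment (`exists_event_quadratic_ge`).

Balance. If the rate exceeds the `L²` diameter bound `2 R M` of the class, nothing is to be shown.
Otherwise `d` is at most polynomial in `N` and `Q` is not below `N ^ (-1/2 + ι)` (`rate_lt_imp`), so
the net is affordable with blocks of length about `N ^ (1 / (2 η₂))`. Only one observation per block
enters the lower bound, and this loss is the `1 / η₂` in the first term of the rate. The failure
probability comes out as `2 / N + C τ₀ ^ (-2) N ^ (-4 ι)`, which the polynomial term of the claim
dominates; small `N` are absorbed by `C₂`. -/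

/-! ### Independence of blocks and a Chernoff bound -/

/-- Functions of disjoint blocks of independent variables are independent; the blocks are the
fibres of `p`. -/
theorem iIndepFun_of_fibers {ι κ Ω E : Type*} [MeasurableSpace Ω] [MeasurableSpace E]
    {μ : Measure Ω} [IsProbabilityMeasure μ] {W : ι → Ω → ℝ} (hW : ∀ x, Measurable (W x))
    (hind : iIndepFun W μ) (p : ι → κ) (G : κ → (ι → ℝ) → E) (hG : ∀ k, Measurable (G k))
    (hdep : ∀ k w w', (∀ x, p x = k → w x = w' x) → G k w = G k w') :
    iIndepFun (fun k ω => G k (fun x => W x ω)) μ := by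
  classical
  -- The joint law of independent variables is a product measure; currying the product over pairs
  -- (block, member) turns it into a product over blocks of products over members.
  have key : iIndepFun (fun k ω (x : {x // p x = k}) => W x.1 ω) μ := by
    let g : ((k : κ) × {x // p x = k}) → ι := fun z => z.2.1
    have hg : Function.Injective g := by
      rintro ⟨k, x, hx⟩ ⟨k', x', hx'⟩ h
      simp only [g] at h
      subst h; subst hx; subst hx'; rfl
    have h1 : iIndepFun (fun z ω => W (g z) ω) μ := hind.precomp hg
    have : ∀ x, IsProbabilityMeasure (μ.map (W x)) := fun x =>
      Measure.isProbabilityMeasure_map (hW x).aemeasurable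
    rw [iIndepFun_iff_map_fun_eq_infinitePi_map (fun k => by fun_prop)]
    have h2 := (iIndepFun_iff_map_fun_eq_infinitePi_map (fun z => hW (g z))).1 h1
    have h3 := congrArg (Measure.map (MeasurableEquiv.piCurry
      (fun (k : κ) (_ : {x // p x = k}) => ℝ))) h2
    rw [Measure.map_map (by fun_prop) (by fun_prop)] at h3
    rw [Measure.infinitePi_map_piCurry
      (fun (k : κ) (x : {x // p x = k}) => μ.map (W x.1))] at h3
    have h4 : (MeasurableEquiv.piCurry (fun (k : κ) (_ : {x // p x = k}) => ℝ)) ∘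
        (fun ω z => W (g z) ω) = fun ω k (x : {x // p x = k}) => W x.1 ω := by
      ext; rfl
    rw [h4] at h3
    rw [h3]
    congr 1
    funext k
    symm
    have h5 : iIndepFun (fun (x : {x // p x = k}) ω => W x.1 ω) μ :=
      hind.precomp Subtype.val_injective
    exact (iIndepFun_iff_map_fun_eq_infinitePi_map (fun z : {x // p x = k} => hW z.1)).1 h5
  -- Coordinates outside the fibre are filled with `0`; by `hdep` this does not change the value.
  have h := key.comp (fun k (w : {x // p x = k} → ℝ) =>
    G k (fun x => if h : p x = k then w ⟨x, h⟩ else 0)) (fun k => by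
      refine (hG k).comp (measurable_pi_lambda _ fun x => ?_)
      by_cases h : p x = k
      · simp only [h, dite_true]; fun_prop
      · simp only [h, dite_false]; fun_prop)
  convert h using 2 with k
  funext ω
  apply hdep
  intro x hx
  simp [hx]

/-- A lower-tail Chernoff bound for the number of occurrences of independent events. -/
theorem measure_count_le {Ω E : Type*} [MeasurableSpace Ω] [MeasurableSpace E]
    {μ : Measure Ω} [IsProbabilityMeasure μ] {Z : ℕ → Ω → E} (hZ : ∀ j, Measurable (Z j))
    (hind : iIndepFun Z μ) {S : Set E} (hS : MeasurableSet S) (n : ℕ) {p : ℝ}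
    (hp : ∀ j, p ≤ μ.real {ω | Z j ω ∈ S}) :
    μ.real {ω | ∑ j ∈ Finset.range n, S.indicator (fun _ => (1 : ℝ)) (Z j ω) ≤ n * p / 2} ≤
      Real.exp (-(n * p / 8)) := by
  set X : ℕ → Ω → ℝ := fun j ω => S.indicator (fun _ => (1 : ℝ)) (Z j ω) with hX
  have hmI : Measurable (S.indicator (fun _ => (1 : ℝ))) := measurable_const.indicator hS
  have hXm : ∀ j, Measurable (X j) := fun j => hmI.comp (hZ j)
  have hXind : iIndepFun X μ := hind.comp (fun _ => S.indicator (fun _ => (1 : ℝ))) fun _ => hmI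
  have hX01 : ∀ j ω, X j ω = 0 ∨ X j ω = 1 := fun j ω => by
    by_cases h : Z j ω ∈ S <;> simp [hX, h]
  have hint : Integrable (fun ω => Real.exp (-1 * (∑ j ∈ Finset.range n, X j) ω)) μ := by
    refine Integrable.of_bound (C := 1) (by fun_prop) (ae_of_all _ fun ω => ?_)
    rw [Real.norm_eq_abs, Real.abs_exp, Real.exp_le_one_iff, Finset.sum_apply]
    have : 0 ≤ ∑ j ∈ Finset.range n, X j ω := Finset.sum_nonneg fun j _ => by
      rcases hX01 j ω with h | h <;> simp [h]
    linarith
  have h1 := measure_le_le_exp_mul_mgf (μ := μ) (X := ∑ j ∈ Finset.range n, X j) (t := -1)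
    (n * p / 2) (by norm_num) hint
  have hmgf : ∀ j, mgf (X j) μ (-1) ≤ Real.exp (-(p * (5 / 8))) := by
    intro j
    have e1 : ∀ ω, Real.exp (-1 * X j ω) =
        1 - (1 - Real.exp (-1)) * ({ω | Z j ω ∈ S}.indicator (fun _ => (1 : ℝ)) ω) := by
      intro ω
      by_cases h : Z j ω ∈ S <;> simp [hX, h]
    have hms : MeasurableSet {ω | Z j ω ∈ S} := hZ j hS
    have e2 : mgf (X j) μ (-1) = 1 - (1 - Real.exp (-1)) * μ.real {ω | Z j ω ∈ S} := by
      rw [mgf, integral_congr_ae (ae_of_all _ e1), integral_sub (integrable_const _)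
        (((integrable_const _).indicator hms).const_mul _), integral_const_mul,
        integral_indicator_const _ hms]
      simp
    rw [e2]
    -- Each factor is then at most `1 - 5 p / 8 ≤ exp (-5 p / 8)`, and `n p / 2 - 5 n p / 8 = -n p /
    -- 8` is the final exponent.
    have he : Real.exp (-1) ≤ 3 / 8 := by
      rw [Real.exp_neg, inv_le_comm₀ (Real.exp_pos _) (by norm_num)]
      have := Real.exp_one_gt_d9
      linarith
    have h0 : (0 : ℝ) ≤ μ.real {ω | Z j ω ∈ S} := measureReal_nonneg
    have h3 := Real.add_one_le_exp (-(p * (5 / 8)))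
    have h4 := hp j
    nlinarith
  have h2 : mgf (∑ j ∈ Finset.range n, X j) μ (-1) ≤ Real.exp (-(p * (5 / 8))) ^ n := by
    rw [hXind.mgf_sum (fun j => hXm j)]
    calc _ ≤ ∏ j ∈ Finset.range n, Real.exp (-(p * (5 / 8))) :=
          Finset.prod_le_prod (fun _ _ => mgf_nonneg) fun j _ => hmgf j
      _ = _ := by simp
  simp only [Finset.sum_apply] at h1
  refine h1.trans ((mul_le_mul_of_nonneg_left h2 (Real.exp_pos _).le).trans (le_of_eq ?_))
  rw [← Real.exp_nat_mul, ← Real.exp_add]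
  congr 1
  ring

/-! ### The minification recursion -/

theorem trial_add (η x₀ : ℝ) (c v : ℕ → ℝ) (n a : ℕ) :
    trial η x₀ c v (n + a) =
      trial η (trial η x₀ c v n) (fun u => c (n + u)) (fun u => v (n + u)) a := by
  induction a with
  | zero => rfl
  | succ a ih => rw [← add_assoc, trial, trial, ih, ← add_assoc]

theorem trial_congr (η x₀ : ℝ) {c c' v v' : ℕ → ℝ} {t : ℕ}
    (h : ∀ u, 1 ≤ u → u ≤ t → c u = c' u ∧ v u = v' u) :
    trial η x₀ c v t = trial η x₀ c' v' t := by
  induction t with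
  | zero => rfl
  | succ t ih =>
    rw [trial, trial, ih fun u h1 h2 => h u h1 (h2.trans t.le_succ),
      (h (t + 1) (by omega) le_rfl).1, (h (t + 1) (by omega) le_rfl).2]

/-- Multiplication by a nonnegative constant and minimum with an innovation both commute with `min`.
This is the coupling mechanism: two chains with the same coins and innovations coincide as soon as
the upper one lies below the free growth of the lower start. -/
theorem trial_eq_min (η : ℝ) {x y : ℝ} (hxy : x ≤ y) (c v : ℕ → ℝ) (t : ℕ) :
    trial η x c v t = min (((2 : ℝ) ^ (1 / η)) ^ t * x) (trial η y c v t) := by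
  have h2 : (0 : ℝ) ≤ (2 : ℝ) ^ (1 / η) := by positivity
  induction t with
  | zero => simp [trial, hxy]
  | succ t ih =>
    rw [trial, trial, ih]
    have e : (2 : ℝ) ^ (1 / η) * min (((2 : ℝ) ^ (1 / η)) ^ t * x) (trial η y c v t) =
        min (((2 : ℝ) ^ (1 / η)) ^ (t + 1) * x) ((2 : ℝ) ^ (1 / η) * trial η y c v t) := by
      rw [mul_min_of_nonneg _ _ h2]; ring_nf
    rw [e]
    split_ifs
    · rfl
    · rw [min_assoc]

theorem measurable_trial {α : Type*} [MeasurableSpace α] (η : ℝ) {x : α → ℝ} {c v : ℕ → α → ℝ}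
    (hx : Measurable x) (hc : ∀ u, Measurable (c u)) (hv : ∀ u, Measurable (v u)) (t : ℕ) :
    Measurable fun w => trial η (x w) (fun u => c u w) (fun u => v u w) t := by
  induction t with
  | zero => exact hx
  | succ t ih =>
    simp only [trial]
    refine Measurable.ite (hc _ (measurableSet_singleton _)) (ih.const_mul _) ?_
    exact (ih.const_mul _).min (hv _)

/-! ### The Pareto law -/

section Pareto

variable {Ω : Type*} [MeasurableSpace Ω] {μ : Measure Ω} [IsProbabilityMeasure μ]

theorem hasParetoLaw_iff_real {V : Ω → ℝ} {η σ : ℝ} (hσ : 0 < σ) :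
    HasParetoLaw μ V η σ ↔ ∀ t : ℝ, 0 < t → μ.real {ω | t < V ω} = 1 / (1 + (σ * t) ^ η) := by
  refine forall₂_congr fun t ht => ?_
  have : 0 ≤ 1 / (1 + (σ * t) ^ η) := by positivity
  rw [measureReal_def]
  constructor
  · intro h; rw [h, ENNReal.toReal_ofReal this]
  · intro h; rw [← h, ENNReal.ofReal_toReal (measure_ne_top _ _)]

/-- The law is prescribed only at `t > 0`; positivity follows by letting `t` decrease to `0`, where
the survival function tends to `1`. -/
theorem HasParetoLaw.measure_pos {V : Ω → ℝ} {η σ : ℝ} (h : HasParetoLaw μ V η σ)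
    (hη : 0 < η) : μ {ω | 0 < V ω} = 1 := by
  refine le_antisymm prob_le_one ?_
  have hc : Filter.Tendsto (fun t : ℝ => ENNReal.ofReal (1 / (1 + (σ * t) ^ η)))
      (nhdsWithin 0 (Set.Ioi 0)) (nhds 1) := by
    have : ContinuousAt (fun t : ℝ => 1 / (1 + (σ * t) ^ η)) 0 := by
      refine continuousAt_const.div ?_ (by simp [Real.zero_rpow hη.ne'])
      refine continuousAt_const.add (ContinuousAt.rpow_const (by fun_prop) (Or.inr hη.le))
    have h2 := (ENNReal.continuous_ofReal.continuousAt.comp this).tendsto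
    simp only [Function.comp_def, mul_zero, Real.zero_rpow hη.ne', add_zero, div_one,
      ENNReal.ofReal_one] at h2
    exact h2.mono_left nhdsWithin_le_nhds
  refine le_of_tendsto hc ?_
  filter_upwards [self_mem_nhdsWithin] with t ht
  rw [← h t ht]
  exact measure_mono fun ω (hω : t < V ω) => lt_trans ht hω

theorem HasParetoLaw.map_eq {V V' : Ω → ℝ} {η σ : ℝ} (h : HasParetoLaw μ V η σ)
    (h' : HasParetoLaw μ V' η σ) (hV : Measurable V) (hV' : Measurable V') (hη : 0 < η) :
    μ.map V = μ.map V' := by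
  have := Measure.isProbabilityMeasure_map (μ := μ) hV.aemeasurable
  have := Measure.isProbabilityMeasure_map (μ := μ) hV'.aemeasurable
  have key : ∀ t, μ {ω | t < V ω} = μ {ω | t < V' ω} := by
    intro t
    rcases lt_or_ge 0 t with ht | ht
    · rw [h t ht, h' t ht]
    · have a : ∀ {U : Ω → ℝ}, HasParetoLaw μ U η σ → μ {ω | t < U ω} = 1 := fun {U} hU =>
        le_antisymm prob_le_one ((hU.measure_pos hη).ge.trans
          (measure_mono fun ω (hω : 0 < U ω) => lt_of_le_of_lt ht hω))
      rw [a h, a h']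
  refine Measure.ext_of_Iic _ _ fun t => ?_
  rw [← Set.compl_Ioi, prob_compl_eq_one_sub measurableSet_Ioi,
    prob_compl_eq_one_sub measurableSet_Ioi, Measure.map_apply hV measurableSet_Ioi,
    Measure.map_apply hV' measurableSet_Ioi]
  exact congrArg (1 - ·) (key t)

/-- One step of the recursion preserves the Pareto law. -/
theorem HasParetoLaw.step {V C D : Ω → ℝ} {η σ : ℝ} (hη : 0 < η) (hσ : 0 < σ)
    (hV : HasParetoLaw μ V η σ) (hD : HasParetoLaw μ D η σ) (hC : μ {ω | C ω = 1} = 1 / 2)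
    (hVm : Measurable V) (hCm : Measurable C) (hDm : Measurable D)
    (hind : iIndepFun ![V, C, D] μ) :
    HasParetoLaw μ (fun ω => if C ω = 1 then (2 : ℝ) ^ (1 / η) * V ω
      else min ((2 : ℝ) ^ (1 / η) * V ω) (D ω)) η σ := by
  rw [hasParetoLaw_iff_real hσ] at hV hD ⊢
  intro t ht
  set c : ℝ := (2 : ℝ) ^ (1 / η) with hc
  have hc0 : 0 < c := by positivity
  have hcη : c ^ η = 2 := by
    rw [hc, ← Real.rpow_mul (by norm_num), one_div_mul_cancel hη.ne', Real.rpow_one]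
  have hCr : μ.real {ω | C ω = 1} = 1 / 2 := by rw [measureReal_def, hC]; simp
  have hCn : μ.real {ω | C ω ≠ 1} = 1 / 2 := by
    have : {ω | C ω ≠ 1} = {ω | C ω = 1}ᶜ := rfl
    have hm : MeasurableSet {ω | C ω = 1} := hCm (measurableSet_singleton 1)
    rw [this, probReal_compl_eq_one_sub hm, hCr]; norm_num
  have hVt : μ.real {ω | t / c < V ω} = 1 / (1 + (σ * t) ^ η / 2) := by
    rw [hV _ (by positivity), ← mul_div_assoc, Real.div_rpow (by positivity) hc0.le, hcη]
  have h3 : ∀ A B E : Set ℝ, MeasurableSet A → MeasurableSet B → MeasurableSet E →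
      μ.real (V ⁻¹' A ∩ C ⁻¹' B ∩ D ⁻¹' E) =
        μ.real (V ⁻¹' A) * μ.real (C ⁻¹' B) * μ.real (D ⁻¹' E) := by
    intro A B E hA hB hE
    have := hind.measure_inter_preimage_eq_mul Finset.univ (sets := ![A, B, E]) (by
      intro i _; fin_cases i <;> simpa)
    simp only [Finset.mem_univ, Set.iInter_true, Fin.prod_univ_three, Fin.isValue,
      Matrix.cons_val_zero, Matrix.cons_val_one, Matrix.cons_val_two, Matrix.head_cons,
      Matrix.tail_cons] at this
    have e : (⋂ i, (![V, C, D] i) ⁻¹' (![A, B, E] i)) = V ⁻¹' A ∩ C ⁻¹' B ∩ D ⁻¹' E := by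
      ext ω
      simp [Fin.forall_fin_succ, and_assoc]
    rw [e] at this
    simp only [measureReal_def, this, ENNReal.toReal_mul]
  have e : {ω | t < if C ω = 1 then c * V ω else min (c * V ω) (D ω)} =
      (V ⁻¹' Set.Ioi (t / c) ∩ C ⁻¹' {1} ∩ D ⁻¹' Set.univ) ∪
      (V ⁻¹' Set.Ioi (t / c) ∩ C ⁻¹' {1}ᶜ ∩ D ⁻¹' Set.Ioi t) := by
    ext ω
    have hdiv : t / c < V ω ↔ t < c * V ω := by rw [div_lt_iff₀ hc0, mul_comm]
    by_cases h : C ω = 1 <;> simp [h, hdiv, -one_div]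
  rw [e, measureReal_union _ (((hVm measurableSet_Ioi).inter
      (hCm (measurableSet_singleton 1).compl)).inter (hDm measurableSet_Ioi)),
    h3 _ _ _ measurableSet_Ioi (measurableSet_singleton 1) MeasurableSet.univ,
    h3 _ _ _ measurableSet_Ioi (measurableSet_singleton 1).compl measurableSet_Ioi]
  · have a1 : V ⁻¹' Set.Ioi (t / c) = {ω | t / c < V ω} := rfl
    have a2 : C ⁻¹' {1} = {ω | C ω = 1} := rfl
    have a3 : C ⁻¹' {1}ᶜ = {ω | C ω ≠ 1} := rfl
    have a4 : D ⁻¹' Set.Ioi t = {ω | t < D ω} := rfl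
    rw [a1, a2, a3, a4, hVt, hCr, hCn, hD t ht, Set.preimage_univ, probReal_univ]
    have : 0 < (σ * t) ^ η := by positivity
    -- With `u = (σ t) ^ η` the two branches add up to `(1/2) (1 / (1 + u/2)) (1 + 1 / (1 + u)) = 1
    -- / (1 + u)`. The factor `2 ^ (1 / η)` is what halves `u`.
    field_simp
    ring
  · rw [Set.disjoint_left]
    rintro ω ⟨⟨_, h1⟩, _⟩ ⟨⟨_, h2⟩, _⟩
    exact h2 h1

end Pareto

/-! ### The input process -/

section Input

variable {Ω : Type*} [MeasurableSpace Ω] {μ : Measure Ω} [IsProbabilityMeasure μ] {d : ℕ}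
  {η : ℝ} {s : Fin d → ℝ} {W : Source d → Ω → ℝ}

theorem measurable_trialCoord (hW : ∀ x, Measurable (W x)) (k : Fin 2) (t : ℕ) (i : Fin d) :
    Measurable (trialCoord η W k t i) :=
  measurable_trial η (hW _) (fun _ => hW _) (fun _ => hW _) t

theorem measurable_input (hW : ∀ x, Measurable (W x)) (t : ℕ) : Measurable (input η W t) := by
  refine measurable_pi_lambda _ fun i => ?_
  exact Measurable.ite (hW _ measurableSet_Iic) (measurable_trialCoord hW 0 t i)
    (measurable_trialCoord hW 1 t i).neg

theorem IsParetoSource.hasParetoLaw_trialCoord (h : IsParetoSource μ η s W) (hη : 0 < η)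
    (hs : ∀ i, 0 < s i) (k : Fin 2) (t : ℕ) (i : Fin d) :
    HasParetoLaw μ (trialCoord η W k t i) η (s i) := by
  induction t with
  | zero => exact h.start_law k i
  | succ t ih =>
    refine ih.step hη (hs i) (h.innov_law k (t + 1) i) (h.coin_one k (t + 1) i)
      (measurable_trialCoord h.measurable k t i) (h.measurable _) (h.measurable _) ?_
    classical
    -- Labels `1` and `2` single out the fresh coin and the fresh innovation; label `0` collects all
    -- other sources, among them the whole past of the trial.
    have := iIndepFun_of_fibers h.measurable h.indep
      (fun x : Source d => if x = .coin k (t + 1) i then (1 : Fin 3)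
        else if x = .innov k (t + 1) i then 2 else 0)
      ![fun w => trialCoord η (fun x w => w x) k t i w, fun w => w (.coin k (t + 1) i),
        fun w => w (.innov k (t + 1) i)] (by
        intro j
        fin_cases j
        · exact measurable_trialCoord (fun x => measurable_pi_apply x) k t i
        · exact measurable_pi_apply _
        · exact measurable_pi_apply _) (by
        intro j w w' hww
        fin_cases j
        · simp only [Fin.zero_eta, Fin.isValue, Matrix.cons_val_zero, trialCoord]
          rw [hww (.start k i) (by simp)]
          refine trial_congr _ _ fun u h1 h2 => ⟨hww _ ?_, hww _ ?_⟩
          · have : u ≠ t + 1 := by omega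
            simp [this]
          · have : u ≠ t + 1 := by omega
            simp [this]
        · exact hww _ (by simp)
        · exact hww _ (by simp))
    convert this using 2 with j
    fin_cases j <;> rfl

/-- The law of the input vector does not depend on time. -/
theorem IsParetoSource.map_input_eq (h : IsParetoSource μ η s W) (hη : 0 < η)
    (hs : ∀ i, 0 < s i) (t t' : ℕ) : μ.map (input η W t) = μ.map (input η W t') := by
  -- At a fixed time the uniform variable (`none`) and the trial coordinates (`some (k, i)`) are
  -- independent, with marginals that do not depend on the time. Hence neither does their joint law,
  -- of which the input is a fixed function.
  let Z : ℕ → Option (Fin 2 × Fin d) → (Source d → ℝ) → ℝ := fun t o =>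
    o.elim (fun w => w (.unif t)) fun ki => trialCoord η (fun x w => w x) ki.1 t ki.2
  have hZm : ∀ t o, Measurable (Z t o) := by
    intro t o
    cases o with
    | none => exact measurable_pi_apply _
    | some ki => exact measurable_trialCoord (fun x => measurable_pi_apply x) _ _ _
  have hWm : Measurable fun ω x => W x ω := measurable_pi_lambda _ h.measurable
  have hind : ∀ t, iIndepFun (fun o ω => Z t o (fun x => W x ω)) μ := fun t =>
    iIndepFun_of_fibers h.measurable h.indep
      (fun x => match x with
        | .start k i => some (k, i)
        | .innov k _ i => some (k, i)
        | .coin k _ i => some (k, i)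
        | .unif _ => none) (Z t) (hZm t) (by
      intro o w w' hww
      cases o with
      | none => exact hww _ rfl
      | some ki =>
        simp only [Z, Option.elim, trialCoord]
        rw [hww (.start ki.1 ki.2) rfl]
        exact trial_congr _ _ fun u _ _ => ⟨hww _ rfl, hww _ rfl⟩)
  have hZW : ∀ t o, Measurable fun ω => Z t o (fun x => W x ω) := fun t o => (hZm t o).comp hWm
  have hmarg : ∀ o, μ.map (fun ω => Z t o (fun x => W x ω)) =
      μ.map (fun ω => Z t' o (fun x => W x ω)) := by
    intro o
    cases o with
    | none => exact (h.unif_law t).trans (h.unif_law t').symm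
    | some ki =>
      exact (h.hasParetoLaw_trialCoord hη hs ki.1 t ki.2).map_eq
        (h.hasParetoLaw_trialCoord hη hs ki.1 t' ki.2)
        (measurable_trialCoord h.measurable _ _ _) (measurable_trialCoord h.measurable _ _ _) hη
  have hjoint : μ.map (fun ω o => Z t o (fun x => W x ω)) =
      μ.map (fun ω o => Z t' o (fun x => W x ω)) := by
    rw [(hind t).map_fun_eq_infinitePi_map (hZW t),
      (hind t').map_fun_eq_infinitePi_map (hZW t')]
    congr 1
    exact funext hmarg
  let g : (Option (Fin 2 × Fin d) → ℝ) → Fin d → ℝ := fun z i =>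
    if z none ≤ 1 / 2 then z (some (0, i)) else -z (some (1, i))
  have hg : Measurable g := by
    refine measurable_pi_lambda _ fun i => ?_
    exact Measurable.ite (measurable_pi_apply none measurableSet_Iic) (measurable_pi_apply _)
      (measurable_pi_apply _).neg
  have := congrArg (Measure.map g) hjoint
  rwa [Measure.map_map hg (measurable_pi_lambda _ (hZW t)),
    Measure.map_map hg (measurable_pi_lambda _ (hZW t'))] at this

/-- The input at time `n + a`, with the recursion restarted at time `n` from deterministic
values `x`. -/
noncomputable def restarted (η : ℝ) (x : Fin d → ℝ) (n a : ℕ) (w : Source d → ℝ) : Fin d → ℝ := fun i =>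
  if w (.unif (n + a)) ≤ 1 / 2 then
    trial η (x i) (fun u => w (.coin 0 (n + u) i)) (fun u => w (.innov 0 (n + u) i)) a
  else -trial η (x i) (fun u => w (.coin 1 (n + u) i)) (fun u => w (.innov 1 (n + u) i)) a

theorem measurable_restarted (η : ℝ) (x : Fin d → ℝ) (n a : ℕ) :
    Measurable (restarted η x n a) := by
  refine measurable_pi_lambda _ fun i => ?_
  refine Measurable.ite (measurable_pi_apply (Source.unif (n + a)) measurableSet_Iic) ?_ ?_
  · exact measurable_trial η measurable_const (fun _ => measurable_pi_apply _)
      (fun _ => measurable_pi_apply _) a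
  · exact (measurable_trial η measurable_const (fun _ => measurable_pi_apply _)
      (fun _ => measurable_pi_apply _) a).neg

/-- Inputs restarted on disjoint time windows are independent. -/
theorem IsParetoSource.iIndepFun_restarted (h : IsParetoSource μ η s W) (x : Fin d → ℝ) {a : ℕ}
    (ha : 0 < a) : iIndepFun (fun j ω => restarted η x (a * j) a (fun y => W y ω)) μ := by
  have hdiv : ∀ j u, 1 ≤ u → u ≤ a → (a * j + u - 1) / a = j := by
    intro j u h1 h2
    rw [Nat.add_sub_assoc h1, Nat.mul_add_div ha, Nat.div_eq_of_lt (by omega), add_zero]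
  refine iIndepFun_of_fibers h.measurable h.indep
    (fun y => match y with
      -- Window `j` reads the times `a * j + 1, …, a * j + a`, hence the shift by one. The starting
      -- values are never read by `restarted`, so their label is arbitrary.
      | .start _ _ => 0
      | .innov _ u _ => (u - 1) / a
      | .coin _ u _ => (u - 1) / a
      | .unif u => (u - 1) / a) (fun j => restarted η x (a * j) a)
    (fun j => measurable_restarted η x _ a) ?_
  intro j w w' hww
  funext i
  simp only [restarted]
  rw [hww (.unif (a * j + a)) (hdiv j a ha le_rfl)]
  rw [trial_congr η (x i) fun u h1 h2 => ⟨hww (.coin 0 (a * j + u) i) (hdiv j u h1 h2),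
    hww (.innov 0 (a * j + u) i) (hdiv j u h1 h2)⟩]
  rw [trial_congr η (x i) fun u h1 h2 => ⟨hww (.coin 1 (a * j + u) i) (hdiv j u h1 h2),
    hww (.innov 1 (a * j + u) i) (hdiv j u h1 h2)⟩]

/-- Restarting the recursion `a` steps before the current time from suitable values changes the
input with exponentially small probability. -/
theorem IsParetoSource.exists_restarted_ne_le (h : IsParetoSource μ η s W) (hη : 0 < η)
    (hs : ∀ i, 0 < s i) (a : ℕ) : ∃ x : Fin d → ℝ, ∀ n,
      μ.real {ω | restarted η x n a (fun y => W y ω) ≠ input η W (n + a) ω} ≤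
        4 * d * (2 : ℝ) ^ (-(a : ℝ) / 2) := by
  set c : ℝ := (2 : ℝ) ^ (1 / η) with hc
  have hc0 : 0 < c := by positivity
  set b : ℝ := (2 : ℝ) ^ (-(a : ℝ) / 2) with hb
  have hb0 : 0 < b := by positivity
  -- The restart value balances two errors: `(s i * x i) ^ η = b`, while after `a` steps of free
  -- growth the same quantity is `2 ^ a * b = 1 / b`. The true chain is below `x i` at time `n`, or
  -- above `c ^ a * x i` at time `n + a`, with probability at most `b` each; there are `2 d` trial
  -- coordinates.
  let x : Fin d → ℝ := fun i => b ^ (1 / η) / s i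
  have hx0 : ∀ i, 0 < x i := fun i => div_pos (by positivity) (hs i)
  have hu : ∀ i, (s i * x i) ^ η = b := fun i => by
    simp only [x]
    rw [mul_div_cancel₀ _ (hs i).ne', ← Real.rpow_mul hb0.le, one_div_mul_cancel hη.ne',
      Real.rpow_one]
  have hcη : (c ^ a) ^ η = 2 ^ (a : ℝ) := by
    rw [hc, ← Real.rpow_natCast, ← Real.rpow_mul (by positivity), ← Real.rpow_mul (by norm_num)]
    congr 1
    field_simp
  have hu2 : ∀ i, (s i * (c ^ a * x i)) ^ η = 1 / b := fun i => by
    rw [mul_left_comm, Real.mul_rpow (pow_pos hc0 a).le (mul_pos (hs i) (hx0 i)).le, hu, hcη, hb,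
      one_div, ← Real.rpow_neg (by norm_num), ← Real.rpow_add (by norm_num)]
    congr 1
    ring
  refine ⟨x, fun n => ?_⟩
  let B : Fin 2 × Fin d → Set Ω := fun ki =>
    {ω | x ki.2 < trialCoord η W ki.1 n ki.2 ω}ᶜ ∪
      {ω | c ^ a * x ki.2 < trialCoord η W ki.1 (n + a) ki.2 ω}
  have hB : ∀ ki, μ.real (B ki) ≤ 2 * b := by
    intro ki
    have p1 := (hasParetoLaw_iff_real (hs ki.2)).1
      (h.hasParetoLaw_trialCoord hη hs ki.1 n ki.2) _ (hx0 ki.2)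
    have p2 := (hasParetoLaw_iff_real (hs ki.2)).1
      (h.hasParetoLaw_trialCoord hη hs ki.1 (n + a) ki.2) (c ^ a * x ki.2)
      (mul_pos (by positivity) (hx0 ki.2))
    rw [hu] at p1
    rw [hu2] at p2
    refine (measureReal_union_le _ _).trans ?_
    rw [probReal_compl_eq_one_sub
      (measurableSet_lt measurable_const (measurable_trialCoord h.measurable _ _ _)), p1, p2]
    have e1 : 1 - 1 / (1 + b) ≤ b := by
      rw [sub_le_iff_le_add, ← sub_le_iff_le_add', le_div_iff₀ (by positivity)]
      nlinarith
    have e2 : 1 / (1 + 1 / b) ≤ b := by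
      rw [div_le_iff₀ (by positivity), mul_add, mul_one_div_cancel hb0.ne']
      linarith
    linarith
  have hsub : {ω | restarted η x n a (fun y => W y ω) ≠ input η W (n + a) ω} ⊆ ⋃ ki, B ki := by
    intro ω hω
    by_contra hn
    refine hω (funext fun i => ?_)
    have key : ∀ k : Fin 2, trial η (x i) (fun u => W (.coin k (n + u) i) ω)
        (fun u => W (.innov k (n + u) i) ω) a = trialCoord η W k (n + a) i ω := by
      intro k
      have hk : ω ∉ B (k, i) := fun hh => hn (Set.mem_iUnion.2 ⟨_, hh⟩)
      have hk1 : x i < trialCoord η W k n i ω := by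
        by_contra hh
        exact hk (Or.inl hh)
      have hk2 : trialCoord η W k (n + a) i ω ≤ c ^ a * x i := by
        by_contra hh
        exact hk (Or.inr (not_le.1 hh))
      have h1 := trial_eq_min η hk1.le (fun u => W (.coin k (n + u) i) ω)
        (fun u => W (.innov k (n + u) i) ω) a
      have h2 : trialCoord η W k (n + a) i ω = trial η (trialCoord η W k n i ω)
          (fun u => W (.coin k (n + u) i) ω) (fun u => W (.innov k (n + u) i) ω) a :=
        trial_add _ _ _ _ n a
      rw [← h2, min_eq_right hk2] at h1
      exact h1
    simp only [restarted, input, key]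
  calc _ ≤ μ.real (⋃ ki, B ki) := measureReal_mono hsub
    _ ≤ ∑ ki, μ.real (B ki) := measureReal_iUnion_fintype_le _
    _ ≤ ∑ _ki : Fin 2 × Fin d, 2 * b := Finset.sum_le_sum fun ki _ => hB ki
    _ = _ := by simp; ring

end Input

/-! ### Second moments -/

/-- A bound for the second moment of a variable whose tail is that of a Pareto law. -/
noncomputable def tailMoment (η : ℝ) : ℝ := 2 + 2 / (η - 2)

theorem tailMoment_pos {η : ℝ} (hη : 2 < η) : 0 < tailMoment η := by
  have : 0 < η - 2 := by linarith
  unfold tailMoment; positivity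

section Moments

variable {Ω : Type*} [MeasurableSpace Ω] {μ : Measure Ω} [IsProbabilityMeasure μ]

/-- Layer-cake formula `2 ∫ t P(|f| > t) dt`, split at `1`: the probability is bounded by `1` below
and by `t ^ (-η)` above. -/
theorem lintegral_sq_le_tailMoment {f : Ω → ℝ} {η : ℝ} (hη : 2 < η) (hf : Measurable f)
    (h : ∀ t, 0 < t → μ {ω | t < |f ω|} ≤ ENNReal.ofReal (1 / (1 + t ^ η))) :
    ∫⁻ ω, ENNReal.ofReal (f ω ^ 2) ∂μ ≤ ENNReal.ofReal (tailMoment η) := by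
  have h1 := lintegral_rpow_eq_lintegral_meas_lt_mul μ (f := fun ω => |f ω|)
    (ae_of_all _ fun ω => abs_nonneg _) (by fun_prop) (p := 2) (by norm_num)
  have e : ∀ ω, |f ω| ^ (2 : ℝ) = f ω ^ 2 := fun ω => by
    rw [Real.rpow_two, sq_abs]
  simp only [e] at h1
  rw [h1, ← Set.Ioc_union_Ioi_eq_Ioi (zero_le_one (α := ℝ)),
    lintegral_union measurableSet_Ioi (Set.Ioc_disjoint_Ioi le_rfl)]
  have b1 : ∫⁻ t in Set.Ioc (0 : ℝ) 1,
      μ {ω | t < |f ω|} * ENNReal.ofReal (t ^ ((2 : ℝ) - 1)) ≤ 1 := by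
    calc _ ≤ ∫⁻ _t in Set.Ioc (0 : ℝ) 1, 1 := by
          refine setLIntegral_mono measurable_const fun t ht => ?_
          refine mul_le_one' prob_le_one ?_
          rw [ENNReal.ofReal_le_one]
          exact Real.rpow_le_one ht.1.le ht.2 (by norm_num)
      _ = 1 := by simp
  have b2 : ∫⁻ t in Set.Ioi (1 : ℝ),
      μ {ω | t < |f ω|} * ENNReal.ofReal (t ^ ((2 : ℝ) - 1)) ≤ ENNReal.ofReal (1 / (η - 2)) := by
    have hlt : 1 - η < -1 := by linarith
    calc _ ≤ ∫⁻ t in Set.Ioi (1 : ℝ), ENNReal.ofReal (t ^ (1 - η)) := by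
          refine setLIntegral_mono (by fun_prop) fun t ht => ?_
          have ht0 : 0 < t := zero_lt_one.trans ht
          refine (mul_le_mul_left (h t ht0) _).trans ?_
          rw [← ENNReal.ofReal_mul (by positivity)]
          refine ENNReal.ofReal_le_ofReal ?_
          have : (2 : ℝ) - 1 = 1 := by norm_num
          rw [this, Real.rpow_sub ht0, Real.rpow_one, div_mul_eq_mul_div, one_mul]
          gcongr
          linarith
      _ = ENNReal.ofReal (∫ t in Set.Ioi (1 : ℝ), t ^ (1 - η)) := by
          rw [ofReal_integral_eq_lintegral_ofReal (integrableOn_Ioi_rpow_of_lt hlt one_pos)]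
          filter_upwards [ae_restrict_mem measurableSet_Ioi] with t ht
          exact Real.rpow_nonneg (zero_lt_one.trans ht).le _
      _ = _ := by
          rw [integral_Ioi_rpow_of_lt hlt one_pos, Real.one_rpow]
          congr 1
          rw [← neg_div_neg_eq, neg_neg]
          congr 1; ring
  calc _ ≤ ENNReal.ofReal 2 * (1 + ENNReal.ofReal (1 / (η - 2))) := by gcongr
    _ = _ := by
      rw [← ENNReal.ofReal_one, ← ENNReal.ofReal_add zero_le_one
        (by have : 0 < η - 2 := by linarith
            positivity), ← ENNReal.ofReal_mul (by norm_num)]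
      congr 1
      unfold tailMoment; ring

theorem memLp_two_of_tail {f : Ω → ℝ} {η : ℝ} (hη : 2 < η) (hf : Measurable f)
    (h : ∀ t, 0 < t → μ {ω | t < |f ω|} ≤ ENNReal.ofReal (1 / (1 + t ^ η))) :
    MemLp f 2 μ := by
  rw [memLp_two_iff_integrable_sq hf.aestronglyMeasurable]
  refine ⟨by fun_prop, ?_⟩
  rw [hasFiniteIntegral_iff_ofReal (ae_of_all _ fun ω => sq_nonneg _)]
  exact (lintegral_sq_le_tailMoment hη hf h).trans_lt ENNReal.ofReal_lt_top

theorem integral_sq_le_tailMoment {f : Ω → ℝ} {η : ℝ} (hη : 2 < η) (hf : Measurable f)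
    (h : ∀ t, 0 < t → μ {ω | t < |f ω|} ≤ ENNReal.ofReal (1 / (1 + t ^ η))) :
    ∫ ω, f ω ^ 2 ∂μ ≤ tailMoment η := by
  rw [integral_eq_lintegral_of_nonneg_ae (ae_of_all _ fun ω => sq_nonneg _) (by fun_prop)]
  exact ENNReal.toReal_le_of_le_ofReal (tailMoment_pos hη).le (lintegral_sq_le_tailMoment hη hf h)

theorem HasParetoLaw.ae_pos {V : Ω → ℝ} {η σ : ℝ} (h : HasParetoLaw μ V η σ) (hη : 0 < η)
    (hV : Measurable V) : ∀ᵐ ω ∂μ, 0 < V ω :=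
  (prob_compl_eq_zero_iff (measurableSet_lt measurable_const hV)).2 (h.measure_pos hη)

/-- Rescaling by `σ` normalizes the parameter to `1`, so that one constant serves all coordinates
and second moments scale as `σ ^ (-2)`. -/
theorem HasParetoLaw.tail_const_mul {V : Ω → ℝ} {η σ : ℝ} (h : HasParetoLaw μ V η σ)
    (hη : 0 < η) (hσ : 0 < σ) (hV : Measurable V) (t : ℝ) (ht : 0 < t) :
    μ {ω | t < |σ * V ω|} ≤ ENNReal.ofReal (1 / (1 + t ^ η)) := by
  have hpos := h.ae_pos hη hV
  have e := h (t / σ) (by positivity)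
  rw [mul_div_cancel₀ _ hσ.ne'] at e
  rw [← e]
  refine measure_mono_ae ?_
  filter_upwards [hpos] with ω hω ht
  have ht : t < |σ * V ω| := ht
  rw [abs_of_pos (by positivity)] at ht
  change t / σ < V ω
  rwa [div_lt_iff₀ hσ, mul_comm]

theorem HasParetoLaw.memLp_two {V : Ω → ℝ} {η σ : ℝ} (h : HasParetoLaw μ V η σ)
    (hη : 2 < η) (hσ : 0 < σ) (hV : Measurable V) : MemLp V 2 μ := by
  have := (memLp_two_of_tail hη (hV.const_mul σ)
    (h.tail_const_mul (by linarith) hσ hV)).const_mul σ⁻¹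
  simpa [hσ.ne'] using this

theorem HasParetoLaw.integral_sq_le {V : Ω → ℝ} {η σ : ℝ} (h : HasParetoLaw μ V η σ)
    (hη : 2 < η) (hσ : 0 < σ) (hV : Measurable V) :
    ∫ ω, V ω ^ 2 ∂μ ≤ tailMoment η / σ ^ 2 := by
  have := integral_sq_le_tailMoment hη (hV.const_mul σ)
    (h.tail_const_mul (by linarith) hσ hV)
  simp only [mul_pow] at this
  rw [integral_const_mul] at this
  rw [le_div_iff₀ (by positivity)]
  linarith

theorem IsParetoSource.memLp_input {d : ℕ} {η : ℝ} {s : Fin d → ℝ} {W : Source d → Ω → ℝ}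
    (h : IsParetoSource μ η s W) (hη : 2 < η) (hs : ∀ i, 0 < s i) (t : ℕ) (i : Fin d) :
    MemLp (fun ω => input η W t ω i) 2 μ := by
  have hV : ∀ k, MemLp (trialCoord η W k t i) 2 μ := fun k =>
    (h.hasParetoLaw_trialCoord (by linarith) hs k t i).memLp_two hη (hs i)
      (measurable_trialCoord h.measurable k t i)
  refine ((hV 0).abs.add (hV 1).abs).mono
    ((measurable_pi_apply i).comp (measurable_input h.measurable t)).aestronglyMeasurable
    (ae_of_all _ fun ω => ?_)
  simp only [input, Pi.add_apply, Pi.abs_apply, Real.norm_eq_abs]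
  have h0 := abs_nonneg (trialCoord η W 0 t i ω)
  have h1 := abs_nonneg (trialCoord η W 1 t i ω)
  rw [abs_of_nonneg (add_nonneg h0 h1)]
  split_ifs
  · linarith
  · rw [abs_neg]; linarith

theorem IsParetoSource.integral_input_sq_le {d : ℕ} {η : ℝ} {s : Fin d → ℝ}
    {W : Source d → Ω → ℝ} (h : IsParetoSource μ η s W) (hη : 2 < η) (hs : ∀ i, 0 < s i)
    (t : ℕ) (i : Fin d) :
    ∫ ω, input η W t ω i ^ 2 ∂μ ≤ 2 * tailMoment η / s i ^ 2 := by
  have hP := fun k => h.hasParetoLaw_trialCoord (by linarith) hs k t i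
  have hm := fun k => measurable_trialCoord (η := η) h.measurable k t i
  have hi : ∀ k, Integrable (fun ω => trialCoord η W k t i ω ^ 2) μ := fun k =>
    ((hP k).memLp_two hη (hs i) (hm k)).integrable_sq
  calc ∫ ω, input η W t ω i ^ 2 ∂μ
      ≤ ∫ ω, (trialCoord η W 0 t i ω ^ 2 + trialCoord η W 1 t i ω ^ 2) ∂μ := by
        refine integral_mono (h.memLp_input hη hs t i).integrable_sq ((hi 0).add (hi 1))
          fun ω => ?_
        simp only [input]
        have h0 := sq_nonneg (trialCoord η W 0 t i ω)
        have h1 := sq_nonneg (trialCoord η W 1 t i ω)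
        split_ifs
        · linarith
        · rw [neg_sq]; linarith
    _ ≤ tailMoment η / s i ^ 2 + tailMoment η / s i ^ 2 := by
        rw [integral_add (hi 0) (hi 1)]
        exact add_le_add ((hP 0).integral_sq_le hη (hs i) (hm 0))
          ((hP 1).integral_sq_le hη (hs i) (hm 1))
    _ = _ := by ring

/-- A dimension-free bound for the second moment of the `ℓ¹` norm of the input. -/
theorem IsParetoSource.integral_norm_sq_le {d : ℕ} {η : ℝ} {s : Fin d → ℝ}
    {W : Source d → Ω → ℝ} (h : IsParetoSource μ η s W) (hη : 2 < η) (hs : ∀ i, 0 < s i)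
    (t : ℕ) :
    Integrable (fun ω => (∑ i, |input η W t ω i|) ^ 2) μ ∧
    ∫ ω, (∑ i, |input η W t ω i|) ^ 2 ∂μ ≤ 2 * tailMoment η * (∑ i, 1 / s i) ^ 2 := by
  have hL : MemLp (fun ω => ∑ i, |input η W t ω i|) 2 μ :=
    memLp_finsetSum _ fun i _ => (h.memLp_input hη hs t i).abs
  refine ⟨hL.integrable_sq, ?_⟩
  have hi : ∀ i, Integrable (fun ω => s i * input η W t ω i ^ 2) μ := fun i =>
    (h.memLp_input hη hs t i).integrable_sq.const_mul _
  calc ∫ ω, (∑ i, |input η W t ω i|) ^ 2 ∂μ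
      ≤ ∫ ω, (∑ i, 1 / s i) * ∑ i, s i * input η W t ω i ^ 2 ∂μ := by
        refine integral_mono hL.integrable_sq
          ((integrable_finsetSum _ fun i _ => hi i).const_mul _) fun ω => ?_
        -- Cauchy–Schwarz with weights `1 / s i`. The second factor has expectation of order `∑ s i
        -- * s i ^ (-2)`, which is again the sum of the weights; no dimension appears.
        refine Finset.sum_sq_le_sum_mul_sum_of_sq_le_mul _ (fun i _ => (one_div_pos.2 (hs i)).le)
          (fun i _ => mul_nonneg (hs i).le (sq_nonneg _)) fun i _ => ?_
        rw [sq_abs, ← mul_assoc, one_div_mul_cancel (hs i).ne', one_mul]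
    _ = (∑ i, 1 / s i) * ∑ i, s i * ∫ ω, input η W t ω i ^ 2 ∂μ := by
        rw [integral_const_mul, integral_finsetSum _ fun i _ => hi i]
        simp only [integral_const_mul]
    _ ≤ (∑ i, 1 / s i) * ∑ i, s i * (2 * tailMoment η / s i ^ 2) := by
        have h0 : 0 ≤ ∑ i, 1 / s i := Finset.sum_nonneg fun i _ => (one_div_pos.2 (hs i)).le
        refine mul_le_mul_of_nonneg_left (Finset.sum_le_sum fun i _ => ?_) h0
        exact mul_le_mul_of_nonneg_left (h.integral_input_sq_le hη hs t i) (hs i).le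
    _ = _ := by
        rw [sq, mul_left_comm, Finset.mul_sum _ _ (2 * tailMoment η)]
        congr 1
        refine Finset.sum_congr rfl fun i _ => ?_
        have := (hs i).ne'
        field_simp

end Moments

/-! ### Sums of products of independent sequences -/

/-- The second moment of a multiplier sum with centred independent multipliers. -/
theorem integral_sq_sum_mul_le {Ω : Type*} [MeasurableSpace Ω] {μ : Measure Ω} {u Z : ℕ → Ω → ℝ} {A B : ℝ} (hu : ∀ t, MemLp (u t) 2 μ)
    (hZ : ∀ t, MemLp (Z t) 2 μ) (hpair : Pairwise fun t t' => IndepFun (u t) (u t') μ)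
    (hmean : ∀ t, ∫ ω, u t ω ∂μ = 0)
    (hind : ∀ t t', IndepFun (fun ω => u t ω * u t' ω) (fun ω => Z t ω * Z t' ω) μ)
    (hA : ∀ t, ∫ ω, u t ω ^ 2 ∂μ ≤ A) (hB : ∀ t, ∫ ω, Z t ω ^ 2 ∂μ ≤ B) (S : Finset ℕ) :
    Integrable (fun ω => (∑ t ∈ S, u t ω * Z t ω) ^ 2) μ ∧
    ∫ ω, (∑ t ∈ S, u t ω * Z t ω) ^ 2 ∂μ ≤ S.card * (A * B) := by
  have hint : ∀ t t', Integrable (fun ω => (u t ω * u t' ω) * (Z t ω * Z t' ω)) μ := fun t t' =>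
    (hind t t').integrable_mul ((hu t).integrable_mul (hu t')) ((hZ t).integrable_mul (hZ t'))
  have e : ∀ ω, (∑ t ∈ S, u t ω * Z t ω) ^ 2 =
      ∑ t ∈ S, ∑ t' ∈ S, (u t ω * u t' ω) * (Z t ω * Z t' ω) := by
    intro ω
    rw [sq, Finset.sum_mul_sum]
    exact Finset.sum_congr rfl fun t _ => Finset.sum_congr rfl fun t' _ => by ring
  simp only [e]
  have hint2 : ∀ t, Integrable (fun ω => ∑ t' ∈ S, (u t ω * u t' ω) * (Z t ω * Z t' ω)) μ :=
    fun t => integrable_finsetSum _ fun t' _ => hint t t'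
  refine ⟨integrable_finsetSum _ fun t _ => hint2 t, ?_⟩
  rw [integral_finsetSum _ fun t _ => hint2 t, ← nsmul_eq_mul]
  refine Finset.sum_le_card_nsmul _ _ _ fun t ht => ?_
  rw [integral_finsetSum _ fun t' _ => hint t t', Finset.sum_eq_single_of_mem t ht]
  · rw [(hind t t).integral_fun_mul_eq_mul_integral
      ((hu t).integrable_mul (hu t)).aestronglyMeasurable
      ((hZ t).integrable_mul (hZ t)).aestronglyMeasurable]
    simp only [← sq]
    exact mul_le_mul (hA t) (hB t) (integral_nonneg fun ω => sq_nonneg _)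
      ((integral_nonneg fun ω => sq_nonneg _).trans (hA t))
  · intro t' _ htt
    rw [(hind t t').integral_fun_mul_eq_mul_integral
      ((hu t).integrable_mul (hu t')).aestronglyMeasurable
      ((hZ t).integrable_mul (hZ t')).aestronglyMeasurable,
      (hpair htt.symm).integral_fun_mul_eq_mul_integral (hu t).aestronglyMeasurable
      (hu t').aestronglyMeasurable, hmean t]
    simp

/-! ### A net of the `ℓ¹` ball in the supremum norm -/

/-- The zero vector and the signed unit vectors. -/
def unitSteps (d : ℕ) : Finset (Fin d → ℤ) :=
  insert 0 ((Finset.univ : Finset (Fin d × Bool)).image fun ib =>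
    Pi.single ib.1 (if ib.2 then 1 else -1))

theorem card_unitSteps_le (d : ℕ) : (unitSteps d).card ≤ 2 * d + 1 := by
  refine (Finset.card_insert_le _ _).trans ?_
  gcongr
  refine Finset.card_image_le.trans ?_
  simp [mul_comm]

/-- The integer points of the `ℓ¹` ball of radius `k` are the sums of `k` unit or zero steps: a
nonzero point can be moved one step towards the origin in some coordinate. Counting the sums bounds
the number of points by `(2 d + 1) ^ k`. -/
theorem mem_nsmul_unitSteps_iff {d k : ℕ} {m : Fin d → ℤ} :
    m ∈ k • unitSteps d ↔ ∑ i, |m i| ≤ k := by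
  induction k generalizing m with
  | zero =>
    simp only [zero_smul, Finset.mem_zero, Nat.cast_zero]
    constructor
    · rintro rfl; simp
    · intro h
      funext i
      have := (Finset.sum_eq_zero_iff_of_nonneg fun i _ => abs_nonneg (m i)).1
        (le_antisymm h (Finset.sum_nonneg fun i _ => abs_nonneg _)) i (Finset.mem_univ i)
      simpa using this
  | succ k ih =>
    rw [succ_nsmul, Finset.mem_add]
    constructor
    · rintro ⟨m', hm', e, he, rfl⟩
      have h1 : ∑ i, |e i| ≤ 1 := by
        rw [unitSteps, Finset.mem_insert, Finset.mem_image] at he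
        rcases he with rfl | ⟨⟨i, b⟩, -, rfl⟩
        · simp
        · rw [Finset.sum_eq_single i (fun j _ hj => by simp [hj]) (by simp)]
          cases b <;> simp
      calc ∑ i, |(m' + e) i| ≤ ∑ i, (|m' i| + |e i|) :=
            Finset.sum_le_sum fun i _ => abs_add_le _ _
        _ ≤ k + 1 := by
            rw [Finset.sum_add_distrib]; exact add_le_add (ih.1 hm') h1
        _ = _ := by push_cast; rfl
    · intro h
      by_cases hm : ∀ i, m i = 0
      · refine ⟨0, ih.2 (by simp), 0, Finset.mem_insert_self _ _, ?_⟩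
        funext i; simp [hm i]
      · push Not at hm
        obtain ⟨i, hi⟩ := hm
        set e : Fin d → ℤ := Pi.single i (if 0 < m i then 1 else -1) with he
        refine ⟨m - e, ih.2 ?_, e, ?_, sub_add_cancel _ _⟩
        · have hpt : ∀ j, |(m - e) j| = |m j| - (Pi.single i 1 : Fin d → ℤ) j := by
            intro j
            by_cases hj : j = i
            · subst hj
              simp only [he, Pi.sub_apply, Pi.single_eq_same]
              split_ifs with hp
              · rw [abs_of_nonneg (by omega), abs_of_pos hp]
              · rw [abs_of_nonpos (by omega), abs_of_nonpos (by omega)]; ring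
            · simp [he, hj]
          have hs : ∑ j, (Pi.single i 1 : Fin d → ℤ) j = 1 := by simp
          rw [Finset.sum_congr rfl fun j _ => hpt j, Finset.sum_sub_distrib, hs]
          push_cast at h
          linarith
        · refine Finset.mem_insert_of_mem (Finset.mem_image.2 ⟨(i, decide (0 < m i)),
            Finset.mem_univ _, ?_⟩)
          simp [he]

/-- The `ℓ¹` ball of radius `R` has a net of at most `(2 d + 1) ^ k` points of mesh `R / k` in the
supremum norm. -/
theorem exists_net_l1Ball (d : ℕ) {k : ℕ} (hk : 0 < k) {R : ℝ} (hR : 0 < R) :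
    ∃ T : Finset (Fin d → ℝ), T.card ≤ (2 * d + 1) ^ k ∧ (∀ θ ∈ T, θ ∈ l1Ball d R) ∧
      ∀ θ ∈ l1Ball d R, ∃ θ' ∈ T, ∀ i, |θ i - θ' i| ≤ R / k := by
  classical
  have hk0 : (0 : ℝ) < k := by exact_mod_cast hk
  refine ⟨(k • unitSteps d).image fun m i => R / k * (m i : ℝ), ?_, ?_, ?_⟩
  · refine Finset.card_image_le.trans (Finset.card_nsmul_le.trans ?_)
    exact Nat.pow_le_pow_left (card_unitSteps_le d) k
  · intro θ hθ
    obtain ⟨m, hm, rfl⟩ := Finset.mem_image.1 hθ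
    have h1 : ((∑ i, |m i| : ℤ) : ℝ) ≤ k := by exact_mod_cast mem_nsmul_unitSteps_iff.1 hm
    push_cast at h1
    change ∑ i, |R / k * (m i : ℝ)| ≤ R
    simp only [abs_mul, abs_of_pos (div_pos hR hk0)]
    rw [← Finset.mul_sum]
    calc _ ≤ R / k * k := by gcongr
      _ = R := by field_simp
  · intro θ hθ
    have hθ : ∑ i, |θ i| ≤ R := hθ
    -- Rounding towards zero does not increase the `ℓ¹` norm, so the rounded point stays in the
    -- ball.
    let m : Fin d → ℤ := fun i => if 0 ≤ θ i then ⌊k * |θ i| / R⌋ else -⌊k * |θ i| / R⌋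
    have hfl : ∀ i, (0 : ℝ) ≤ (⌊k * |θ i| / R⌋ : ℝ) := fun i => by
      exact_mod_cast Int.floor_nonneg.2 (by positivity)
    refine ⟨_, Finset.mem_image.2 ⟨m, mem_nsmul_unitSteps_iff.2 ?_, rfl⟩, fun i => ?_⟩
    · have : ((∑ i, |m i| : ℤ) : ℝ) ≤ k := by
        push_cast
        calc ∑ i, |(m i : ℝ)| ≤ ∑ i, k / R * |θ i| := by
              refine Finset.sum_le_sum fun i _ => ?_
              have h1 : |(m i : ℝ)| = ⌊k * |θ i| / R⌋ := by
                simp only [m]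
                split_ifs
                · exact abs_of_nonneg (hfl i)
                · push_cast; rw [abs_neg]; exact abs_of_nonneg (hfl i)
              rw [h1]
              refine (Int.floor_le _).trans (le_of_eq (by ring))
          _ ≤ k / R * R := by rw [← Finset.mul_sum]; gcongr
          _ = k := by field_simp
      exact_mod_cast this
    · have h1 := Int.floor_le ((k : ℝ) * |θ i| / R)
      have h2 := (Int.lt_floor_add_one ((k : ℝ) * |θ i| / R)).le
      have e1 : R / k * ((k : ℝ) * |θ i| / R) = |θ i| := by field_simp
      have h3 := mul_le_mul_of_nonneg_left h1 (div_pos hR hk0).le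
      have h4 := mul_le_mul_of_nonneg_left h2 (div_pos hR hk0).le
      rw [e1] at h3 h4
      rw [mul_add, mul_one] at h4
      simp only [m]
      rw [abs_le]
      split_ifs with hs
      · rw [abs_of_nonneg hs] at *
        constructor <;> linarith
      · push_cast
        rw [abs_of_neg (not_le.1 hs)] at *
        constructor <;> linarith

/-! ### Linear functionals and their norms -/

theorem linearFun_sub {d : ℕ} (θ θ' : Fin d → ℝ) :
    linearFun θ - linearFun θ' = linearFun (θ - θ') := by
  funext x
  simp [linearFun, sub_mul]

theorem sub_mem_l1Ball {d : ℕ} {R : ℝ} {θ θ' : Fin d → ℝ} (h : θ ∈ l1Ball d R)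
    (h' : θ' ∈ l1Ball d R) : θ - θ' ∈ l1Ball d (2 * R) := by
  have h : ∑ i, |θ i| ≤ R := h
  have h' : ∑ i, |θ' i| ≤ R := h'
  change ∑ i, |θ i - θ' i| ≤ 2 * R
  calc _ ≤ ∑ i, (|θ i| + |θ' i|) := Finset.sum_le_sum fun i _ => abs_sub _ _
    _ ≤ 2 * R := by rw [Finset.sum_add_distrib]; linarith

/-- By symmetry and convexity of the ball, `δ = δ / 2 - (-δ / 2)`. -/
theorem linearFun_mem_sub {d : ℕ} {R : ℝ} {δ : Fin d → ℝ} (h : δ ∈ l1Ball d (2 * R)) :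
    linearFun δ ∈ linearClass d R - linearClass d R := by
  have h : ∑ i, |δ i| ≤ 2 * R := h
  have hh : ∑ i, |(1 / 2 : ℝ) * δ i| ≤ R := by
    simp only [abs_mul]
    rw [← Finset.mul_sum, abs_of_pos (by norm_num)]
    linarith
  refine Set.mem_sub.2 ⟨linearFun fun i => 1 / 2 * δ i, ⟨_, hh, rfl⟩,
    linearFun fun i => -(1 / 2 * δ i), ⟨_, ?_, rfl⟩, ?_⟩
  · change ∑ i, |-(1 / 2 * δ i)| ≤ R
    simpa only [abs_neg] using hh
  · rw [linearFun_sub]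
    congr 1
    funext i
    simp only [Pi.sub_apply]
    ring

theorem abs_linearFun_le {d : ℕ} {δ x : Fin d → ℝ} {c : ℝ} (h : ∀ i, |δ i| ≤ c) :
    |linearFun δ x| ≤ c * ∑ i, |x i| := by
  calc _ ≤ ∑ i, |δ i * x i| := Finset.abs_sum_le_sum_abs _ _
    _ ≤ ∑ i, c * |x i| := Finset.sum_le_sum fun i _ => by
        rw [abs_mul]; exact mul_le_mul_of_nonneg_right (h i) (abs_nonneg _)
    _ = _ := (Finset.mul_sum _ _ _).symm

theorem abs_apply_le_of_mem_l1Ball {d : ℕ} {R : ℝ} {δ : Fin d → ℝ} (h : δ ∈ l1Ball d R)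
    (i : Fin d) : |δ i| ≤ R :=
  (Finset.single_le_sum (f := fun i => |δ i|) (fun _ _ => abs_nonneg _)
    (Finset.mem_univ i)).trans h

theorem measurable_linearFun {d : ℕ} (δ : Fin d → ℝ) : Measurable (linearFun δ) := by
  unfold linearFun; fun_prop

section Norm

variable {Ω : Type*} [MeasurableSpace Ω] {μ : Measure Ω} {d : ℕ}
  {X : Ω → Fin d → ℝ}

theorem l2Norm_map (hX : Measurable X) (δ : Fin d → ℝ) :
    l2Norm (μ.map X) (linearFun δ) = Real.sqrt (∫ ω, linearFun δ (X ω) ^ 2 ∂μ) := by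
  rw [l2Norm, integral_map hX.aemeasurable
    ((measurable_linearFun δ).pow_const 2).aestronglyMeasurable]

theorem l2Norm_nonneg (π : Measure (Fin d → ℝ)) (h : (Fin d → ℝ) → ℝ) : 0 ≤ l2Norm π h :=
  Real.sqrt_nonneg _

theorem memLp_linearFun (hX2 : ∀ i, MemLp (fun ω => X ω i) 2 μ) (δ : Fin d → ℝ) :
    MemLp (fun ω => linearFun δ (X ω)) 2 μ :=
  memLp_finsetSum _ fun i _ => (hX2 i).const_mul (δ i)

theorem sq_l2Norm_map (hX : Measurable X) (δ : Fin d → ℝ) :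
    l2Norm (μ.map X) (linearFun δ) ^ 2 = ∫ ω, linearFun δ (X ω) ^ 2 ∂μ := by
  rw [l2Norm_map hX, Real.sq_sqrt (integral_nonneg fun ω => sq_nonneg _)]

/-- Duality between the supremum norm and the `ℓ¹` norm. With the dimension-free `M`, a net in the
supremum norm becomes a net in `L²` at no cost in the dimension. -/
theorem l2Norm_le_of_abs_le (hX : Measurable X) {M c : ℝ}
    (hX2 : ∀ i, MemLp (fun ω => X ω i) 2 μ)
    (hM : ∫ ω, (∑ i, |X ω i|) ^ 2 ∂μ ≤ M ^ 2) (hM0 : 0 ≤ M) (hc : 0 ≤ c) {δ : Fin d → ℝ}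
    (hδ : ∀ i, |δ i| ≤ c) : l2Norm (μ.map X) (linearFun δ) ≤ c * M := by
  have hL : MemLp (fun ω => ∑ i, |X ω i|) 2 μ := memLp_finsetSum _ fun i _ => (hX2 i).abs
  rw [l2Norm_map hX]
  refine Real.sqrt_le_iff.2 ⟨by positivity, ?_⟩
  calc ∫ ω, linearFun δ (X ω) ^ 2 ∂μ ≤ ∫ ω, c ^ 2 * (∑ i, |X ω i|) ^ 2 ∂μ := by
        refine integral_mono (memLp_linearFun hX2 δ).integrable_sq
          (hL.integrable_sq.const_mul _) fun ω => ?_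
        simp only []
        rw [← mul_pow, ← sq_abs]
        exact pow_le_pow_left₀ (abs_nonneg _) (abs_linearFun_le hδ) 2
    _ ≤ (c * M) ^ 2 := by rw [integral_const_mul, mul_pow]; gcongr

theorem l2Norm_add_le (hX : Measurable X) (hX2 : ∀ i, MemLp (fun ω => X ω i) 2 μ)
    (δ ε : Fin d → ℝ) : l2Norm (μ.map X) (linearFun δ) ≤
      l2Norm (μ.map X) (linearFun ε) + l2Norm (μ.map X) (linearFun (δ - ε)) := by
  have key : ∀ δ : Fin d → ℝ, ENNReal.ofReal (l2Norm (μ.map X) (linearFun δ)) =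
      eLpNorm (fun ω => linearFun δ (X ω)) 2 μ := by
    intro δ
    rw [l2Norm_map hX, (memLp_linearFun hX2 δ).eLpNorm_eq_integral_rpow_norm (by norm_num)
      (by norm_num)]
    simp [Real.sqrt_eq_rpow]
  have h := eLpNorm_add_le (μ := μ) (p := 2) (memLp_linearFun hX2 ε).aestronglyMeasurable
    (memLp_linearFun hX2 (δ - ε)).aestronglyMeasurable (by norm_num)
  have e : (fun ω => linearFun ε (X ω)) + (fun ω => linearFun (δ - ε) (X ω)) =
      fun ω => linearFun δ (X ω) := by
    funext ω
    simp [linearFun, sub_mul]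
  rw [e, ← key, ← key, ← key, ← ENNReal.ofReal_add (l2Norm_nonneg _ _) (l2Norm_nonneg _ _)] at h
  exact (ENNReal.ofReal_le_ofReal_iff (add_nonneg (l2Norm_nonneg _ _) (l2Norm_nonneg _ _))).1 h

/-! ### The population risk -/

theorem integral_sq_sub_response {υ : Ω → ℝ} (hX : Measurable X)
    (hX2 : ∀ i, MemLp (fun ω => X ω i) 2 μ) (hυ : MemLp υ 2 μ) (hmean : ∫ ω, υ ω ∂μ = 0)
    (hind : IndepFun υ X μ) (θ θ' : Fin d → ℝ) :
    ∫ ω, (linearFun θ (X ω) - (∑ i, θ' i * X ω i + υ ω)) ^ 2 ∂μ =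
      l2Norm (μ.map X) (linearFun (θ - θ')) ^ 2 + ∫ ω, υ ω ^ 2 ∂μ := by
  have hL := memLp_linearFun hX2 (θ - θ')
  have e : ∀ ω, (linearFun θ (X ω) - (∑ i, θ' i * X ω i + υ ω)) ^ 2 =
      linearFun (θ - θ') (X ω) ^ 2 + υ ω ^ 2 - 2 * (υ ω * linearFun (θ - θ') (X ω)) := by
    intro ω
    rw [← linearFun_sub]
    simp only [Pi.sub_apply, linearFun]
    ring
  have hi : IndepFun υ (fun ω => linearFun (θ - θ') (X ω)) μ :=
    hind.comp measurable_id (measurable_linearFun (θ - θ'))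
  have i1 : Integrable (fun ω => linearFun (θ - θ') (X ω) ^ 2 + υ ω ^ 2) μ :=
    hL.integrable_sq.add hυ.integrable_sq
  have i2 : Integrable (fun ω => 2 * (υ ω * linearFun (θ - θ') (X ω))) μ :=
    (hυ.integrable_mul hL).const_mul 2
  simp only [e]
  rw [integral_sub i1 i2, integral_add hL.integrable_sq hυ.integrable_sq,
    integral_const_mul, hi.integral_fun_mul_eq_mul_integral hυ.aestronglyMeasurable
    hL.aestronglyMeasurable, hmean, sq_l2Norm_map hX]
  ring

/-! ### The small-ball function -/

theorem smallBall_le (hX : Measurable X) {R : ℝ} {δ : Fin d → ℝ} (h : δ ∈ l1Ball d (2 * R))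
    (u : ℝ) : smallBall (μ.map X) (linearClass d R - linearClass d R) u ≤
      μ.real {ω | u * l2Norm (μ.map X) (linearFun δ) ≤ |linearFun δ (X ω)|} := by
  have hbdd : BddBelow ((fun h => (μ.map X).real {x | u * l2Norm (μ.map X) h ≤ |h x|}) ''
      (linearClass d R - linearClass d R)) :=
    ⟨0, by rintro _ ⟨h, -, rfl⟩; exact measureReal_nonneg⟩
  refine (csInf_le hbdd ⟨_, linearFun_mem_sub h, rfl⟩).trans (le_of_eq ?_)
  exact map_measureReal_apply hX
    (measurableSet_le measurable_const (measurable_linearFun δ).abs)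

/-- Markov's inequality for the square of one nondegenerate functional. It limits how large `τ` can
be: `τ * √Q ≤ 1 / 2`, used in comparing the mesh with the rate. -/
theorem sq_mul_smallBall_le (hX : Measurable X) (hX2 : ∀ i, MemLp (fun ω => X ω i) 2 μ) {R τ : ℝ}
    (hτ : 0 < τ) {δ : Fin d → ℝ} (h : δ ∈ l1Ball d (2 * R))
    (hpos : 0 < l2Norm (μ.map X) (linearFun δ)) :
    4 * τ ^ 2 * smallBall (μ.map X) (linearClass d R - linearClass d R) (2 * τ) ≤ 1 := by
  set m := l2Norm (μ.map X) (linearFun δ) with hm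
  have h1 := smallBall_le (μ := μ) hX h (2 * τ)
  have h2 := mul_meas_ge_le_integral_of_nonneg (μ := μ)
    (f := fun ω => linearFun δ (X ω) ^ 2) (ae_of_all _ fun ω => sq_nonneg _)
    (memLp_linearFun hX2 δ).integrable_sq ((2 * τ * m) ^ 2)
  rw [← sq_l2Norm_map hX, ← hm] at h2
  have e : {ω | (2 * τ * m) ^ 2 ≤ linearFun δ (X ω) ^ 2} = {ω | 2 * τ * m ≤ |linearFun δ (X ω)|} := by
    ext ω
    change (2 * τ * m) ^ 2 ≤ linearFun δ (X ω) ^ 2 ↔ 2 * τ * m ≤ |linearFun δ (X ω)|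
    rw [← sq_abs (linearFun δ (X ω)), pow_le_pow_iff_left₀ (by positivity) (abs_nonneg _) (by norm_num)]
  rw [e] at h2
  rw [← hm] at h1
  have h3 : 4 * τ ^ 2 * μ.real {ω | 2 * τ * m ≤ |linearFun δ (X ω)|} ≤ 1 := by
    have : 0 < m ^ 2 := by positivity
    rw [← mul_le_mul_iff_of_pos_left this]
    linarith
  refine le_trans ?_ h3
  gcongr

variable [IsProbabilityMeasure μ]

/-- On a finite-dimensional space of square integrable variables the `L²` norm is bounded by a
multiple of the `L¹` norm. -/
theorem exists_mul_l2_le_l1 (hX2 : ∀ i, MemLp (fun ω => X ω i) 2 μ) :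
    ∃ c : ℝ, 0 < c ∧ ∀ δ : Fin d → ℝ,
      c * Real.sqrt (∫ ω, linearFun δ (X ω) ^ 2 ∂μ) ≤ ∫ ω, |linearFun δ (X ω)| ∂μ := by
  have m2 := fun δ => memLp_linearFun hX2 δ
  have m1 : ∀ δ, MemLp (fun ω => linearFun δ (X ω)) 1 μ := fun δ =>
    (m2 δ).mono_exponent (by norm_num)
  have hadd : ∀ δ ε : Fin d → ℝ, (fun ω => linearFun (δ + ε) (X ω)) =
      (fun ω => linearFun δ (X ω)) + fun ω => linearFun ε (X ω) := fun δ ε => by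
    funext ω; simp [linearFun, add_mul, Finset.sum_add_distrib]
  have hsmul : ∀ (a : ℝ) (δ : Fin d → ℝ), (fun ω => linearFun (a • δ) (X ω)) =
      a • fun ω => linearFun δ (X ω) := fun a δ => by
    funext ω; simp [linearFun, mul_assoc, Finset.mul_sum]
  let T2 : (Fin d → ℝ) →ₗ[ℝ] Lp ℝ 2 μ :=
    { toFun := fun δ => (m2 δ).toLp _
      map_add' := fun δ ε => by
        rw [← MemLp.toLp_add]; exact MemLp.toLp_congr _ _ (by rw [hadd])
      map_smul' := fun a δ => by
        simp only [RingHom.id_apply]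
        rw [← MemLp.toLp_const_smul]; exact MemLp.toLp_congr _ _ (by rw [hsmul]) }
  let T1 : (Fin d → ℝ) →ₗ[ℝ] Lp ℝ 1 μ :=
    { toFun := fun δ => (m1 δ).toLp _
      map_add' := fun δ ε => by
        rw [← MemLp.toLp_add]; exact MemLp.toLp_congr _ _ (by rw [hadd])
      map_smul' := fun a δ => by
        simp only [RingHom.id_apply]
        rw [← MemLp.toLp_const_smul]; exact MemLp.toLp_congr _ _ (by rw [hsmul]) }
  have n2 : ∀ δ, ‖T2 δ‖ = Real.sqrt (∫ ω, linearFun δ (X ω) ^ 2 ∂μ) := by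
    intro δ
    change ‖(m2 δ).toLp _‖ = _
    rw [Lp.norm_toLp, (m2 δ).eLpNorm_eq_integral_rpow_norm (by norm_num) (by norm_num),
      ENNReal.toReal_ofReal (Real.rpow_nonneg (integral_nonneg fun ω => by positivity) _)]
    simp [Real.sqrt_eq_rpow]
  have n1 : ∀ δ, ‖T1 δ‖ = ∫ ω, |linearFun δ (X ω)| ∂μ := by
    intro δ
    change ‖(m1 δ).toLp _‖ = _
    rw [Lp.norm_toLp, (m1 δ).eLpNorm_eq_integral_rpow_norm (by norm_num) (by norm_num),
      ENNReal.toReal_ofReal (Real.rpow_nonneg (integral_nonneg fun ω => by positivity) _)]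
    simp
  have hker : LinearMap.ker T1 ≤ LinearMap.ker T2 := by
    intro δ hδ
    rw [LinearMap.mem_ker] at hδ ⊢
    have h1 : (fun ω => linearFun δ (X ω)) =ᵐ[μ] 0 :=
      (MemLp.toLp_eq_toLp_iff (m1 δ) MemLp.zero).1 (hδ.trans (MemLp.toLp_zero _).symm)
    exact ((MemLp.toLp_eq_toLp_iff (m2 δ) MemLp.zero).2 h1).trans (MemLp.toLp_zero _)
  -- Both kernels consist of the almost surely vanishing functionals, so the `L²` embedding factors
  -- through the range of the `L¹` embedding; a linear map on this finite-dimensional range is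
  -- bounded.
  let g : (LinearMap.range T1) →ₗ[ℝ] Lp ℝ 2 μ :=
    ((LinearMap.ker T1).liftQ T2 hker) ∘ₗ T1.quotKerEquivRange.symm.toLinearMap
  have hg : ∀ δ, T2 δ = g ⟨T1 δ, LinearMap.mem_range_self _ _⟩ := by
    intro δ
    have : T1.quotKerEquivRange.symm ⟨T1 δ, LinearMap.mem_range_self _ _⟩ =
        Submodule.Quotient.mk δ := by
      rw [LinearEquiv.symm_apply_eq]; rfl
    simp only [g, LinearMap.comp_apply, LinearEquiv.coe_coe, this]
    rfl
  let G : (LinearMap.range T1) →L[ℝ] Lp ℝ 2 μ := LinearMap.toContinuousLinearMap g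
  refine ⟨1 / (‖G‖ + 1), by positivity, fun δ => ?_⟩
  rw [← n2, ← n1, one_div_mul_eq_div, div_le_iff₀ (by positivity), hg]
  have h := G.le_opNorm ⟨T1 δ, LinearMap.mem_range_self _ _⟩
  have h' : ‖g ⟨T1 δ, LinearMap.mem_range_self _ _⟩‖ ≤ ‖G‖ * ‖T1 δ‖ := h
  have h0 := norm_nonneg (T1 δ)
  linarith

/-- The small-ball condition can be met for any class of linear functionals. -/
theorem exists_smallBall_pos (hX : Measurable X) (hX2 : ∀ i, MemLp (fun ω => X ω i) 2 μ) {R : ℝ}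
    (hR : 0 ≤ R) :
    ∃ τ : ℝ, 0 < τ ∧ 0 < smallBall (μ.map X) (linearClass d R - linearClass d R) (2 * τ) := by
  obtain ⟨c₀, hc₀, hc⟩ := exists_mul_l2_le_l1 hX2
  -- Capping at `1` keeps `c ^ 2 / 4 ≤ 1`, needed for functionals of zero norm, whose small-ball
  -- probability is `1`.
  set c := min c₀ 1 with hcdef
  have hc1 : c ≤ 1 := min_le_right _ _
  have hcpos : 0 < c := lt_min hc₀ one_pos
  refine ⟨c / 4, by positivity, lt_of_lt_of_le (show 0 < c ^ 2 / 4 by positivity) ?_⟩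
  have hne : (linearClass d R - linearClass d R).Nonempty :=
    ⟨_, linearFun_mem_sub (δ := 0) (by change ∑ i, |(0 : ℝ)| ≤ 2 * R; simpa using hR)⟩
  refine le_csInf (hne.image _) ?_
  rintro _ ⟨h, hh, rfl⟩
  obtain ⟨_, ⟨θ, hθ, rfl⟩, _, ⟨θ', hθ', rfl⟩, rfl⟩ := Set.mem_sub.1 hh
  simp only [linearFun_sub]
  set δ := θ - θ'
  set m := l2Norm (μ.map X) (linearFun δ) with hm
  set A : Set Ω := {ω | 2 * (c / 4) * m ≤ |linearFun δ (X ω)|} with hA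
  have hmA : MeasurableSet A :=
    measurableSet_le measurable_const ((measurable_linearFun δ).comp hX).abs
  have e : (μ.map X).real {x | 2 * (c / 4) * m ≤ |linearFun δ x|} = μ.real A := by
    rw [measureReal_def, Measure.map_apply hX
      (measurableSet_le measurable_const (measurable_linearFun δ).abs)]
    rfl
  rw [e]
  have hm0 : 0 ≤ m := l2Norm_nonneg _ _
  rcases hm0.eq_or_lt with h0 | h0
  · have : A = Set.univ := by
      refine Set.eq_univ_of_forall fun ω => ?_
      change 2 * (c / 4) * m ≤ |linearFun δ (X ω)|
      rw [← h0, mul_zero]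
      exact abs_nonneg _
    rw [this, probReal_univ]
    nlinarith
  · have hint := (memLp_linearFun hX2 δ)
    have hle : c * m ≤ ∫ ω, |linearFun δ (X ω)| ∂μ := by
      refine le_trans ?_ (hc δ)
      rw [← l2Norm_map hX]
      exact mul_le_mul_of_nonneg_right (min_le_left _ _) hm0
    have i1 : Integrable (fun ω => c / (4 * m) * linearFun δ (X ω) ^ 2) μ :=
      hint.integrable_sq.const_mul _
    have i2 : Integrable (fun ω => c / 2 * m + c / (4 * m) * linearFun δ (X ω) ^ 2) μ :=
      (integrable_const _).add i1
    have i3 : Integrable (A.indicator fun _ => m / c) μ := (integrable_const _).indicator hmA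
    -- A Paley–Zygmund argument. Off `A` the functional is below `c m / 2`; on `A`, the
    -- arithmetic–geometric mean inequality bounds it by `c f ^ 2 / (4 m) + m / c`. Integrating
    -- gives `c m ≤ (3/4) c m + P(A) m / c`.
    have hle2 : ∫ ω, |linearFun δ (X ω)| ∂μ ≤ ∫ ω, ((c / 2 * m + c / (4 * m) *
        linearFun δ (X ω) ^ 2) + A.indicator (fun _ => m / c) ω) ∂μ := by
      refine integral_mono (hint.integrable (by norm_num)).abs
        (i2.add i3) fun ω => ?_
      simp only []
      by_cases hω : ω ∈ A
      · rw [Set.indicator_of_mem hω]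
        have h2 : |linearFun δ (X ω)| ≤ c / (4 * m) * linearFun δ (X ω) ^ 2 + m / c := by
          rw [← sq_abs (linearFun δ (X ω))]
          have h3 := sq_nonneg (c * |linearFun δ (X ω)| - 2 * m)
          have e : c / (4 * m) * |linearFun δ (X ω)| ^ 2 + m / c =
              ((c * |linearFun δ (X ω)|) ^ 2 + 4 * m ^ 2) / (4 * m * c) := by
            field_simp
          rw [e, le_div_iff₀ (by positivity)]
          nlinarith
        have : 0 ≤ c / 2 * m := by positivity
        linarith
      · rw [Set.indicator_of_notMem hω]
        have h1 : |linearFun δ (X ω)| < 2 * (c / 4) * m := not_le.1 hω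
        have : 0 ≤ c / (4 * m) * linearFun δ (X ω) ^ 2 := by positivity
        linarith
    rw [integral_add i2 i3, integral_add (integrable_const _) i1, integral_const, integral_const_mul,
      ← sq_l2Norm_map hX, ← hm, integral_indicator_const _ hmA, probReal_univ] at hle2
    simp only [smul_eq_mul, one_mul] at hle2
    have e2 : c / (4 * m) * m ^ 2 = c / 4 * m := by field_simp
    rw [e2] at hle2
    have h4 : c / 4 * m ≤ μ.real A * (m / c) := by linarith
    have h5 : c / 4 * m * (c / m) ≤ μ.real A * (m / c) * (c / m) := by gcongr
    have e3 : c / 4 * m * (c / m) = c ^ 2 / 4 := by field_simp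
    have e4 : μ.real A * (m / c) * (c / m) = μ.real A := by field_simp
    rwa [e3, e4] at h5

end Norm

/-! ### The quadratic process -/

section Quadratic

variable {Ω : Type*} [MeasurableSpace Ω] {μ : Measure Ω} [IsProbabilityMeasure μ] {d : ℕ}
  {η : ℝ} {s : Fin d → ℝ} {W : Source d → Ω → ℝ}

/-- Each functional of the class is large, at inputs of controlled size, with probability close to
the value of the small-ball function. -/
theorem IsParetoSource.smallBall_sub_le (h : IsParetoSource μ η s W) (hη : 2 < η)
    (hs : ∀ i, 0 < s i) {M R τ L : ℝ} (hM : 2 * tailMoment η * (∑ i, 1 / s i) ^ 2 ≤ M ^ 2)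
    (hL : 0 < L) {δ : Fin d → ℝ} (hδ : δ ∈ l1Ball d (2 * R)) (t : ℕ) :
    smallBall (μ.map (input η W 1)) (linearClass d R - linearClass d R) (2 * τ) - M ^ 2 / L ^ 2 ≤
      μ.real {ω | input η W t ω ∈ {x : Fin d → ℝ | 2 * τ * l2Norm (μ.map (input η W 1))
        (linearFun δ) ≤ |linearFun δ x| ∧ ∑ i, |x i| ≤ L}} := by
  have hm := measurable_input (η := η) h.measurable
  rw [h.map_input_eq (by linarith) hs 1 t]
  set m := l2Norm (μ.map (input η W t)) (linearFun δ)
  have h1 := smallBall_le (μ := μ) (hm t) hδ (2 * τ)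
  obtain ⟨hi, hle⟩ := h.integral_norm_sq_le hη hs t
  have h2 := mul_meas_ge_le_integral_of_nonneg (μ := μ)
    (f := fun ω => (∑ i, |input η W t ω i|) ^ 2) (ae_of_all _ fun ω => sq_nonneg _) hi (L ^ 2)
  have h3 : μ.real {ω | L ^ 2 ≤ (∑ i, |input η W t ω i|) ^ 2} ≤ M ^ 2 / L ^ 2 := by
    rw [le_div_iff₀ (by positivity), mul_comm]
    exact h2.trans (hle.trans hM)
  have h4 : {ω | 2 * τ * m ≤ |linearFun δ (input η W t ω)|} ⊆
      {ω | input η W t ω ∈ {x : Fin d → ℝ | 2 * τ * m ≤ |linearFun δ x| ∧ ∑ i, |x i| ≤ L}} ∪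
      {ω | L ^ 2 ≤ (∑ i, |input η W t ω i|) ^ 2} := by
    intro ω hω
    rcases le_or_gt (∑ i, |input η W t ω i|) L with hc | hc
    · exact Or.inl ⟨hω, hc⟩
    · exact Or.inr (pow_le_pow_left₀ hL.le hc.le 2)
  have h5 := (measureReal_mono (μ := μ) h4).trans (measureReal_union_le _ _)
  linarith

/-- Outside an event of small probability, the empirical second moments along a subsequence of
times are bounded below, uniformly over the functionals whose norm is not too small. -/
theorem IsParetoSource.exists_event_quadratic_ge (h : IsParetoSource μ η s W) (hη : 2 < η)
    (hs : ∀ i, 0 < s i) {M R τ q r : ℝ} (hM0 : 0 < M) (hR : 0 < R) (hτ : 0 < τ) (hq : 0 < q)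
    (hM : 2 * tailMoment η * (∑ i, 1 / s i) ^ 2 ≤ M ^ 2)
    (hqs : q = smallBall (μ.map (input η W 1)) (linearClass d R - linearClass d R) (2 * τ))
    {a k : ℕ} (n : ℕ) (ha : 0 < a) (hk : 0 < k)
    (hr : 2 * R / k * M ≤ r / 4) (hr' : 2 * R / k * (4 * M / Real.sqrt q) ≤ τ * r / 2)
    (had : 4 * d * (2 : ℝ) ^ (-(a : ℝ) / 2) ≤ q / 4) :
    ∃ E : Set Ω, μ.real E ≤ n * (4 * d * (2 : ℝ) ^ (-(a : ℝ) / 2)) +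
        (2 * d + 1) ^ k * Real.exp (-(n * q / 16)) ∧
      ∀ ω ∉ E, ∀ δ ∈ l1Ball d (2 * R), r ≤ l2Norm (μ.map (input η W 1)) (linearFun δ) →
        n * q / 4 * (τ * l2Norm (μ.map (input η W 1)) (linearFun δ)) ^ 2 ≤
          ∑ j ∈ Finset.range n, linearFun δ (input η W (a * j + a) ω) ^ 2 := by
  have hm := measurable_input (η := η) h.measurable
  have hX2 := h.memLp_input hη hs 1
  have hk0 : (0 : ℝ) < k := by exact_mod_cast hk
  set π := μ.map (input η W 1) with hπ
  obtain ⟨x, hx⟩ := h.exists_restarted_ne_le (by linarith) hs a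
  obtain ⟨T, hTc, hTb, hT⟩ := exists_net_l1Ball d hk (R := 2 * R) (by linarith)
  -- With this truncation level, Markov's inequality loses only `M ^ 2 / L ^ 2 = q / 16`.
  set L := 4 * M / Real.sqrt q with hL
  have hL0 : 0 < L := by positivity
  have hML : M ^ 2 / L ^ 2 = q / 16 := by
    rw [hL, div_pow, mul_pow, Real.sq_sqrt hq.le]
    field_simp
    norm_num
  let S : (Fin d → ℝ) → Set (Fin d → ℝ) := fun θ =>
    {y | 2 * τ * l2Norm π (linearFun θ) ≤ |linearFun θ y| ∧ ∑ i, |y i| ≤ L}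
  have hS : ∀ θ, MeasurableSet (S θ) := fun θ =>
    (measurableSet_le measurable_const (measurable_linearFun θ).abs).inter
      (measurableSet_le (Finset.measurable_sum _ fun i _ => (measurable_pi_apply i).abs)
        measurable_const)
  let Z : ℕ → Ω → Fin d → ℝ := fun j ω => restarted η x (a * j) a (fun y => W y ω)
  have hZm : ∀ j, Measurable (Z j) := fun j =>
    (measurable_restarted η x _ a).comp (measurable_pi_lambda _ h.measurable)
  let D : ℕ → Set Ω := fun j => {ω | Z j ω ≠ input η W (a * j + a) ω}
  -- Truncation costs `q / 16` and coupling at most `q / 4`, so at least `q / 2` of the small-ball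
  -- probability survives for the restarted, independent inputs.
  have hp : ∀ θ ∈ T, ∀ j, q / 2 ≤ μ.real {ω | Z j ω ∈ S θ} := by
    intro θ hθ j
    have h1 := h.smallBall_sub_le hη hs (τ := τ) hM hL0 (hTb θ hθ) (a * j + a)
    rw [← hqs, hML] at h1
    have h2 : {ω | input η W (a * j + a) ω ∈ S θ} ⊆ {ω | Z j ω ∈ S θ} ∪ D j := by
      intro ω hω
      by_cases hD : ω ∈ D j
      · exact Or.inr hD
      · have e : Z j ω = input η W (a * j + a) ω := not_not.1 hD
        left
        change Z j ω ∈ S θ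
        rw [e]
        exact hω
    have h3 := (measureReal_mono (μ := μ) h2).trans (measureReal_union_le _ _)
    have h4 : μ.real (D j) ≤ q / 4 := (hx _).trans had
    have h5 : q - q / 16 ≤ μ.real {ω | input η W (a * j + a) ω ∈ S θ} := h1
    linarith
  let C : (Fin d → ℝ) → Set Ω := fun θ =>
    {ω | ∑ j ∈ Finset.range n, (S θ).indicator (fun _ => (1 : ℝ)) (Z j ω) ≤ n * (q / 2) / 2}
  refine ⟨(⋃ j ∈ Finset.range n, D j) ∪ ⋃ θ ∈ T, C θ, ?_, ?_⟩
  · refine (measureReal_union_le _ _).trans (add_le_add ?_ ?_)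
    · refine (measureReal_biUnion_finset_le _ _).trans ?_
      refine (Finset.sum_le_sum fun j _ => hx (a * j)).trans (le_of_eq ?_)
      simp
    · refine (measureReal_biUnion_finset_le _ _).trans ?_
      have : ∀ θ ∈ T, μ.real (C θ) ≤ Real.exp (-(n * q / 16)) := by
        intro θ hθ
        refine (measure_count_le hZm (h.iIndepFun_restarted x ha) (hS θ) n (hp θ hθ)).trans
          (le_of_eq ?_)
        congr 1
        ring
      refine (Finset.sum_le_card_nsmul _ _ _ this).trans ?_
      rw [nsmul_eq_mul]
      gcongr
      exact_mod_cast hTc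
  · intro ω hω δ hδ hδr
    obtain ⟨θ, hθT, hθ⟩ := hT δ hδ
    set m := l2Norm π (linearFun δ) with hm'
    have hZX : ∀ j ∈ Finset.range n, Z j ω = input η W (a * j + a) ω := by
      intro j hj
      by_contra hne
      exact hω (Or.inl (Set.mem_biUnion hj hne))
    have hC : n * (q / 2) / 2 <
        ∑ j ∈ Finset.range n, (S θ).indicator (fun _ => (1 : ℝ)) (Z j ω) := by
      by_contra hne
      exact hω (Or.inr (Set.mem_biUnion hθT (not_lt.1 hne)))
    have hnorm : m ≤ l2Norm π (linearFun θ) + r / 4 := by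
      refine (l2Norm_add_le (hm 1) hX2 δ θ).trans (add_le_add le_rfl (le_trans ?_ hr))
      exact l2Norm_le_of_abs_le (hm 1) hX2 ((h.integral_norm_sq_le hη hs 1).2.trans hM) hM0.le
        (by positivity) hθ
    have hpt : ∀ j ∈ Finset.range n, (τ * m) ^ 2 * (S θ).indicator (fun _ => (1 : ℝ)) (Z j ω) ≤
        linearFun δ (input η W (a * j + a) ω) ^ 2 := by
      intro j hj
      by_cases hmem : Z j ω ∈ S θ
      · rw [Set.indicator_of_mem hmem, mul_one, ← sq_abs (linearFun δ _)]
        have hm0 : 0 ≤ m := l2Norm_nonneg _ _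
        refine pow_le_pow_left₀ (by positivity) ?_ 2
        rw [hZX j hj] at hmem
        set y := input η W (a * j + a) ω
        obtain ⟨hy1, hy2⟩ := hmem
        -- Since `‖θ‖ ≥ m - r / 4`, the net point gives at least `2 τ m - τ r / 2`; replacing `θ` by
        -- `δ` costs another `τ r / 2`, and `r ≤ m` leaves `τ m`.
        have e1 : |linearFun (δ - θ) y| ≤ τ * r / 2 := by
          refine (abs_linearFun_le (c := 2 * R / k) hθ).trans (le_trans ?_ hr')
          gcongr
        rw [← linearFun_sub, Pi.sub_apply] at e1
        have e2 := abs_sub_abs_le_abs_sub (linearFun θ y) (linearFun δ y)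
        rw [abs_sub_comm] at e2
        have e3 : τ * r ≤ τ * m := by gcongr
        have e4 : τ * m ≤ τ * (l2Norm π (linearFun θ) + r / 4) := by gcongr
        linarith
      · rw [Set.indicator_of_notMem hmem, mul_zero]
        positivity
    refine le_trans ?_ (Finset.sum_le_sum hpt)
    rw [← Finset.mul_sum, mul_comm]
    refine mul_le_mul_of_nonneg_left (le_trans (le_of_eq (by ring)) hC.le) (sq_nonneg _)

end Quadratic

/-! ### The multiplier process -/

section Multiplier

variable {Ω : Type*} [MeasurableSpace Ω] {μ : Measure Ω} [IsProbabilityMeasure μ] {d : ℕ}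

theorem IsPolynomialNoise.memLp_two {η : ℝ} {X : ℕ → Ω → Fin d → ℝ} {υ : ℕ → Ω → ℝ}
    (h : IsPolynomialNoise μ η X υ) (hη : 2 < η) (t : ℕ) : MemLp (υ t) 2 μ :=
  memLp_two_of_tail hη (h.measurable t) fun x hx =>
    (measure_mono fun ω (hω : x < |υ t ω|) => hω.le).trans (h.tail t x hx)

theorem IsPolynomialNoise.integral_sq_le {η : ℝ} {X : ℕ → Ω → Fin d → ℝ} {υ : ℕ → Ω → ℝ}
    (h : IsPolynomialNoise μ η X υ) (hη : 2 < η) (t : ℕ) :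
    ∫ ω, υ t ω ^ 2 ∂μ ≤ tailMoment η :=
  integral_sq_le_tailMoment hη (h.measurable t) fun x hx =>
    (measure_mono fun ω (hω : x < |υ t ω|) => hω.le).trans (h.tail t x hx)

/-- A dimension-free tail bound for the maximum of the coordinates of the multiplier process. -/
theorem IsPolynomialNoise.measure_exists_le_abs_sum {η η' : ℝ} {s : Fin d → ℝ}
    {W : Source d → Ω → ℝ} {υ : ℕ → Ω → ℝ} (hW : IsParetoSource μ η s W) (hη : 2 < η)
    (hs : ∀ i, 0 < s i) (h : IsPolynomialNoise μ η' (input η W) υ) (hη' : 2 < η') {ℓ : ℝ}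
    (hℓ : 0 < ℓ) (N : ℕ) :
    μ.real {ω | ∃ i, ℓ ≤ |∑ t ∈ Finset.Icc 1 N, υ t ω * input η W t ω i|} ≤
      N * (tailMoment η' * (2 * tailMoment η * ∑ i, 1 / s i ^ 2)) / ℓ ^ 2 := by
  have hbound : ∀ i, μ.real {ω | ℓ ≤ |∑ t ∈ Finset.Icc 1 N, υ t ω * input η W t ω i|} ≤
      N * (tailMoment η' * (2 * tailMoment η / s i ^ 2)) / ℓ ^ 2 := by
    intro i
    obtain ⟨hi, hle⟩ := integral_sq_sum_mul_le (μ := μ) (u := υ)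
      (Z := fun t ω => input η W t ω i) (h.memLp_two hη')
      (fun t => hW.memLp_input hη hs t i) (fun t t' htt => h.indep.indepFun htt) h.mean_zero
      (fun t t' => h.indep_input.comp (φ := fun w : ℕ → ℝ => w t * w t')
        (ψ := fun w : ℕ → Fin d → ℝ => w t i * w t' i) (by fun_prop) (by fun_prop))
      (h.integral_sq_le hη') (fun t => hW.integral_input_sq_le hη hs t i) (Finset.Icc 1 N)
    rw [Nat.card_Icc, Nat.add_sub_cancel] at hle
    have h2 := mul_meas_ge_le_integral_of_nonneg (μ := μ) (ae_of_all _ fun ω => sq_nonneg _) hi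
      (ℓ ^ 2)
    rw [le_div_iff₀ (by positivity), mul_comm]
    refine le_trans (mul_le_mul_of_nonneg_left (measureReal_mono fun ω hω => ?_) (sq_nonneg ℓ))
      (h2.trans hle)
    change ℓ ^ 2 ≤ (∑ t ∈ Finset.Icc 1 N, υ t ω * input η W t ω i) ^ 2
    rw [← sq_abs (∑ t ∈ Finset.Icc 1 N, υ t ω * input η W t ω i)]
    exact pow_le_pow_left₀ hℓ.le hω 2
  have e : {ω | ∃ i, ℓ ≤ |∑ t ∈ Finset.Icc 1 N, υ t ω * input η W t ω i|} =
      ⋃ i, {ω | ℓ ≤ |∑ t ∈ Finset.Icc 1 N, υ t ω * input η W t ω i|} := by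
    ext ω
    rw [Set.mem_iUnion]
    rfl
  rw [e]
  refine (measureReal_iUnion_fintype_le _).trans ((Finset.sum_le_sum fun i _ => hbound i).trans
    (le_of_eq ?_))
  simp only [Finset.mul_sum, Finset.sum_div]
  exact Finset.sum_congr rfl fun i _ => by ring

end Multiplier

/-! ### The basic inequality of least squares -/

/-- An empirical risk minimizer has small empirical distance to the true functional if the
multiplier process is small. -/
theorem IsEmpiricalRiskMinimizer.sum_sq_le {d : ℕ} {R ℓ : ℝ} {N : ℕ} (hN : 1 ≤ N)
    {x : ℕ → Fin d → ℝ} {u y : ℕ → ℝ} {θ δ : Fin d → ℝ} (hθ : θ ∈ l1Ball d R)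
    (hδ : δ ∈ l1Ball d (2 * R)) (hy : ∀ t, y t = linearFun θ (x t) + u t)
    (h : IsEmpiricalRiskMinimizer (linearClass d R) N x y (linearFun (θ + δ)))
    (hℓ : ∀ i, |∑ t ∈ Finset.Icc 1 N, u t * x t i| ≤ ℓ) (hℓ0 : 0 ≤ ℓ) :
    ∑ t ∈ Finset.Icc 1 N, linearFun δ (x t) ^ 2 ≤ 4 * R * ℓ := by
  have hδ : ∑ i, |δ i| ≤ 2 * R := hδ
  have h1 := h.2 _ ⟨θ, hθ, rfl⟩
  have hN0 : (0 : ℝ) < 1 / N := by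
    have : (0 : ℝ) < N := by exact_mod_cast hN
    positivity
  rw [mul_le_mul_iff_of_pos_left hN0] at h1
  have e1 : ∀ t, (linearFun (θ + δ) (x t) - y t) ^ 2 = linearFun δ (x t) ^ 2 -
      2 * (u t * linearFun δ (x t)) + u t ^ 2 := by
    intro t
    have : linearFun (θ + δ) (x t) = linearFun θ (x t) + linearFun δ (x t) := by
      simp [linearFun, add_mul, Finset.sum_add_distrib]
    rw [hy, this]
    ring
  have e2 : ∀ t, (linearFun θ (x t) - y t) ^ 2 = u t ^ 2 := by
    intro t; rw [hy]; ring
  simp only [e1, e2, Finset.sum_add_distrib, Finset.sum_sub_distrib] at h1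
  rw [← Finset.mul_sum] at h1
  have e3 : ∑ t ∈ Finset.Icc 1 N, u t * linearFun δ (x t) =
      ∑ i, δ i * ∑ t ∈ Finset.Icc 1 N, u t * x t i := by
    simp only [linearFun, Finset.mul_sum]
    rw [Finset.sum_comm]
    exact Finset.sum_congr rfl fun i _ => Finset.sum_congr rfl fun t _ => by ring
  have e4 : ∑ i, δ i * ∑ t ∈ Finset.Icc 1 N, u t * x t i ≤ 2 * R * ℓ := by
    calc _ ≤ ∑ i, |δ i| * ℓ := Finset.sum_le_sum fun i _ => by
          refine (le_abs_self _).trans ?_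
          rw [abs_mul]
          exact mul_le_mul_of_nonneg_left (hℓ i) (abs_nonneg _)
      _ ≤ _ := by rw [← Finset.sum_mul]; gcongr
  linarith

/-! ### The choice of the block length and of the mesh -/

/-- Blocks of length `x ^ γ`, for any `γ > 0`, make the coupling error beat any power of the sample
size, hence also a dimension polynomial in it. -/
theorem eventually_rpow_le_two_rpow {γ : ℝ} (hγ : 0 < γ) (b : ℝ) :
    ∀ᶠ x : ℝ in Filter.atTop, 16 * x ^ b ≤ (2 : ℝ) ^ (x ^ γ / 2) := by
  have h1 := (isLittleO_rpow_exp_pos_mul_atTop (b / γ)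
    (show 0 < Real.log 2 / 2 by have := Real.log_pos one_lt_two; positivity)).bound
    (show (0 : ℝ) < 1 / 16 by norm_num)
  have h2 := (tendsto_rpow_atTop hγ).eventually h1
  filter_upwards [h2, Filter.eventually_gt_atTop 0] with x hx hx0
  rw [← Real.rpow_mul hx0.le, mul_div_cancel₀ _ hγ.ne', Real.norm_eq_abs, Real.norm_eq_abs,
    Real.abs_exp, abs_of_pos (Real.rpow_pos_of_pos hx0 b)] at hx
  rw [Real.rpow_def_of_pos (zero_lt_two' ℝ)]
  have e : Real.log 2 * (x ^ γ / 2) = Real.log 2 / 2 * x ^ γ := by ring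
  rw [e]
  linarith

theorem eventually_log_le (A B : ℝ) :
    ∀ᶠ x : ℝ in Filter.atTop, A + B * Real.log x ≤ x ^ (1 / 4 : ℝ) := by
  have h1 : (fun _ : ℝ => A) =o[Filter.atTop] fun x : ℝ => x ^ (1 / 4 : ℝ) :=
    Asymptotics.isLittleO_const_left.2 (Or.inr
      (tendsto_norm_atTop_atTop.comp (tendsto_rpow_atTop (by norm_num))))
  have h2 : (fun x => B * Real.log x) =o[Filter.atTop] fun x : ℝ => x ^ (1 / 4 : ℝ) :=
    (isLittleO_log_rpow_atTop (by norm_num)).const_mul_left B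
  filter_upwards [(h1.add h2).bound one_pos, Filter.eventually_gt_atTop 0] with x hx hx0
  rw [one_mul, Real.norm_eq_abs, Real.norm_eq_abs, abs_of_pos (Real.rpow_pos_of_pos hx0 _)] at hx
  exact (le_abs_self _).trans hx

set_option maxHeartbeats 800000 in
/-- For large samples, blocks of length about `N ^ (1 / (2 e))` make both the coupling error and
the deviation probabilities of the empirical counts over a net negligible. -/
theorem exists_block_parameters {ι e : ℝ} (hι : 0 < ι) (he : 2 < e) (hι' : ι < 1 / 4) :
    ∃ N₀ : ℕ, ∀ N : ℕ, N₀ ≤ N → ∀ (d : ℕ) (q : ℝ), (d : ℝ) ≤ (N : ℝ) ^ (e / 2) →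
      (N : ℝ) ^ (-(1 / 2 : ℝ) + ι) ≤ q → ∃ a k n : ℕ, 0 < a ∧ 0 < k ∧ a * n ≤ N ∧
        16 * q * (N : ℝ) ^ (1 / 2 - ι) ≤ k ∧ 4 * d * (2 : ℝ) ^ (-(a : ℝ) / 2) ≤ q / 4 ∧
        n * (4 * d * (2 : ℝ) ^ (-(a : ℝ) / 2)) +
          (2 * d + 1) ^ k * Real.exp (-(n * q / 16)) ≤ 2 / N ∧
        (N : ℝ) ^ (1 - 1 / (2 * e)) / 4 ≤ n := by
  -- This exponent makes the number of blocks times the squared first rate term equal to `N ^ (1/2 +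
  -- 2 ι)` up to a constant, as `multiplier_bound_le` requires. Since `γ < 1 / 4`, the net entropy,
  -- of order `q N ^ (1/2 - ι) log N`, stays below `q N ^ (1 - γ)`.
  set γ : ℝ := 1 / (2 * e) with hγ
  have hγ0 : 0 < γ := by positivity
  have hγ1 : γ < 1 / 4 := by
    rw [hγ]
    exact one_div_lt_one_div_of_lt (by norm_num) (by linarith)
  -- The power `e / 2 + 2` covers `d ≤ N ^ (e / 2)` and leaves a coupling error of order `N ^ (-2)`
  -- per block. The constant `2176 = 17 * 128` comes from `k ≤ 17 q N ^ (1/2 - ι)` and the target `q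
  -- N ^ (1 - γ) / 128`.
  have ev := (((eventually_rpow_le_two_rpow hγ0 (e / 2 + 2)).and
    (eventually_log_le (2176 * 2) (2176 * (e / 2)))).and (eventually_log_le 0 128)).and
    (Filter.eventually_ge_atTop (16 : ℝ))
  obtain ⟨N₀, hN₀⟩ := Filter.eventually_atTop.1
    (tendsto_natCast_atTop_atTop.eventually ev)
  refine ⟨N₀, fun N hN d q hd hq => ?_⟩
  obtain ⟨⟨⟨h1, h2⟩, h3⟩, h16⟩ := hN₀ N hN
  set x : ℝ := (N : ℝ) with hx
  have hx0 : 0 < x := by linarith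
  have hx1 : 1 ≤ x := by linarith
  have hq0 : 0 < q := lt_of_lt_of_le (by positivity) hq
  set y : ℝ := x ^ γ with hy
  have hy1 : 1 ≤ y := Real.one_le_rpow hx1 hγ0.le
  have hxy : x ^ (1 - γ) * y = x := by
    rw [hy, ← Real.rpow_add hx0, sub_add_cancel, Real.rpow_one]
  set a : ℕ := ⌈y⌉₊ with ha
  have ha0 : 0 < a := Nat.ceil_pos.2 (by linarith)
  have hya : y ≤ a := Nat.le_ceil y
  have hay : (a : ℝ) ≤ 2 * y := by
    have := (Nat.ceil_lt_add_one (show 0 ≤ y by linarith)).le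
    linarith
  set k : ℕ := ⌈16 * q * x ^ (1 / 2 - ι)⌉₊ with hk
  have hqx : 1 ≤ q * x ^ (1 / 2 - ι) := by
    have : x ^ (-(1 / 2 : ℝ) + ι) * x ^ (1 / 2 - ι) = 1 := by
      rw [← Real.rpow_add hx0]
      have : -(1 / 2 : ℝ) + ι + (1 / 2 - ι) = 0 := by ring
      rw [this, Real.rpow_zero]
    refine this.ge.trans ?_
    gcongr
  have hk0 : 0 < k := Nat.ceil_pos.2 (by positivity)
  have hk17 : (k : ℝ) ≤ 17 * (q * x ^ (1 / 2 - ι)) := by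
    have := (Nat.ceil_lt_add_one (show 0 ≤ 16 * q * x ^ (1 / 2 - ι) by positivity)).le
    linarith
  set n : ℕ := N / a with hn
  have hn1 : x ^ (1 - γ) / 4 ≤ n := by
    have e1 : x < a * (n + 1) := by
      have := Nat.lt_mul_div_succ N ha0
      rw [hx]
      exact_mod_cast this
    have e2 : x ^ (1 - γ) * y ≤ 2 * y * (n + 1) := by
      rw [hxy]
      refine e1.le.trans ?_
      gcongr
    have e3 : x ^ (1 - γ) ≤ 2 * (n + 1) := by
      have : y * x ^ (1 - γ) ≤ y * (2 * (n + 1)) := by linarith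
      exact le_of_mul_le_mul_left this (by linarith)
    have e4 : (4 : ℝ) ≤ x ^ (1 - γ) := by
      calc (4 : ℝ) = (16 : ℝ) ^ (1 / 2 : ℝ) := by
            rw [← Real.sqrt_eq_rpow, show (16 : ℝ) = 4 ^ 2 by norm_num,
              Real.sqrt_sq (by norm_num)]
        _ ≤ x ^ (1 / 2 : ℝ) := by gcongr
        _ ≤ x ^ (1 - γ) := Real.rpow_le_rpow_of_exponent_le hx1 (by linarith)
    linarith
  have hnN : (n : ℝ) ≤ x := by
    rw [hx]; exact_mod_cast Nat.div_le_self N a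
  have hcoup : 4 * d * (2 : ℝ) ^ (-(a : ℝ) / 2) ≤ 1 / (4 * x ^ 2) := by
    have e1 : (2 : ℝ) ^ (-(a : ℝ) / 2) ≤ ((2 : ℝ) ^ (y / 2))⁻¹ := by
      rw [← Real.rpow_neg (by norm_num)]
      exact Real.rpow_le_rpow_of_exponent_le (by norm_num) (by linarith)
    have e2 : ((2 : ℝ) ^ (y / 2))⁻¹ ≤ (16 * x ^ (e / 2 + 2))⁻¹ := by
      gcongr
    calc 4 * d * (2 : ℝ) ^ (-(a : ℝ) / 2) ≤ 4 * x ^ (e / 2) * (16 * x ^ (e / 2 + 2))⁻¹ := by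
          gcongr
          exact e1.trans e2
      _ = 1 / (4 * x ^ 2) := by
          rw [Real.rpow_add hx0, Real.rpow_two]
          have : 0 < x ^ (e / 2) := by positivity
          field_simp
          norm_num
  refine ⟨a, k, n, ha0, hk0, Nat.mul_div_le N a, Nat.le_ceil _, ?_, ?_, hn1⟩
  · refine hcoup.trans ?_
    have e1 : 1 / x ^ 2 ≤ q := by
      refine le_trans ?_ hq
      rw [one_div, ← Real.rpow_two, ← Real.rpow_neg hx0.le]
      exact Real.rpow_le_rpow_of_exponent_le hx1 (by linarith)
    have e2 : 1 / (4 * x ^ 2) = 1 / x ^ 2 / 4 := by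
      field_simp
    rw [e2]
    linarith
  · have c1 : n * (4 * d * (2 : ℝ) ^ (-(a : ℝ) / 2)) ≤ 1 / x := by
      calc _ ≤ x * (1 / (4 * x ^ 2)) := by gcongr
        _ ≤ x * (1 / x ^ 2) := by
            gcongr
            nlinarith [sq_nonneg x]
        _ = 1 / x := by field_simp
    have hlog : 0 ≤ Real.log x := Real.log_nonneg hx1
    have c2 : ((2 * d + 1 : ℝ)) ≤ Real.exp (2 + e / 2 * Real.log x) := by
      have e1 : Real.exp (2 + e / 2 * Real.log x) = Real.exp 2 * x ^ (e / 2) := by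
        rw [Real.exp_add, Real.rpow_def_of_pos hx0, mul_comm (e / 2)]
      have e2 : (3 : ℝ) ≤ Real.exp 2 := by
        have := Real.add_one_le_exp (2 : ℝ)
        linarith
      have e3 : 1 ≤ x ^ (e / 2) := Real.one_le_rpow hx1 (by linarith)
      rw [e1]
      nlinarith
    have c3 : k * (2 + e / 2 * Real.log x) ≤ q * x ^ (1 - γ) / 128 := by
      have hpos : 0 ≤ 2 + e / 2 * Real.log x := by positivity
      calc (k : ℝ) * (2 + e / 2 * Real.log x)
          ≤ 17 * (q * x ^ (1 / 2 - ι)) * (2 + e / 2 * Real.log x) := by gcongr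
        _ = q * x ^ (1 / 2 - ι) * (2176 * 2 + 2176 * (e / 2) * Real.log x) / 128 := by ring
        _ ≤ q * x ^ (1 / 2 - ι) * x ^ (1 / 4 : ℝ) / 128 := by gcongr
        _ = q * x ^ (1 / 2 - ι + 1 / 4) / 128 := by rw [mul_assoc, ← Real.rpow_add hx0]
        _ ≤ q * x ^ (1 - γ) / 128 := by
            gcongr
            linarith
    have c4 : 128 * Real.log x ≤ q * x ^ (1 - γ) := by
      calc 128 * Real.log x ≤ x ^ (1 / 4 : ℝ) := by linarith
        _ ≤ x ^ (-(1 / 2 : ℝ) + ι + (1 - γ)) :=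
            Real.rpow_le_rpow_of_exponent_le hx1 (by linarith)
        _ = x ^ (-(1 / 2 : ℝ) + ι) * x ^ (1 - γ) := Real.rpow_add hx0 _ _
        _ ≤ _ := by gcongr
    -- The Chernoff exponent is at least `q N ^ (1 - γ) / 64`: one half pays for the net (`c3`), the
    -- other for the remaining factor `1 / N` (`c4`).
    have c5 : q * x ^ (1 - γ) / 64 ≤ n * q / 16 := by nlinarith
    have c6 : (2 * d + 1 : ℝ) ^ k * Real.exp (-(n * q / 16)) ≤ 1 / x := by
      calc (2 * d + 1 : ℝ) ^ k * Real.exp (-(n * q / 16))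
          ≤ Real.exp (2 + e / 2 * Real.log x) ^ k * Real.exp (-(n * q / 16)) := by gcongr
        _ = Real.exp (k * (2 + e / 2 * Real.log x) - n * q / 16) := by
            rw [← Real.exp_nat_mul, ← Real.exp_add, sub_eq_add_neg]
        _ ≤ Real.exp (-Real.log x) := by
            rw [Real.exp_le_exp]
            linarith
        _ = 1 / x := by rw [Real.exp_neg, Real.exp_log hx0, one_div]
    have : 2 / x = 1 / x + 1 / x := by rw [← add_div, one_add_one_eq_two]
    rw [this]
    exact add_le_add c1 c6

/-- Bounding a probability by a fractional power of an upper bound. -/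
theorem le_const_mul_rpow_of_le_add {P A B C p : ℝ} (hP : P ≤ 1) (hA : 0 ≤ A) (hC : 0 ≤ C)
    (hB : 0 ≤ B) (hp0 : 0 ≤ p) (hp1 : p ≤ 1) (h : P ≤ B + C * A) (hBA : B ≤ 2 * A ^ p) :
    P ≤ (3 + C) * A ^ p := by
  have hAp : 0 ≤ A ^ p := Real.rpow_nonneg hA p
  rcases le_total A 1 with h1 | h1
  · have h2 : A ≤ A ^ p := by
      rcases hA.eq_or_lt with h0 | h0
      · rw [← h0]; exact Real.rpow_nonneg le_rfl p
      · simpa using Real.rpow_le_rpow_of_exponent_ge h0 h1 hp1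
    have := mul_le_mul_of_nonneg_left h2 hC
    linarith
  · have h2 : 1 ≤ A ^ p := Real.one_le_rpow h1 hp0
    have := mul_le_mul_of_nonneg_left h2 hC
    nlinarith

/-! ### The rate -/

/-- A rate below the diameter bound forces `d ^ α N ^ (-1/2 + ι) < 2 τ q ^ (3/2) ≤ q`, because `τ √q
≤ 1 / 2`. Dropping the factor `d ^ α ≥ 1` gives the first conclusion; `q ≤ 1` and `α ≥ 1 / e` give
the second. -/
theorem rate_lt_imp {ι e R τ q M : ℝ} {d N : ℕ} (hι : 0 < ι) (he : 2 < e) (hι' : ι < 1 / 4)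
    (hR : 0 < R) (hτ : 0 < τ) (hq : 0 < q) (hq1 : q ≤ 1) (hM : 0 < M) (hτq : τ * Real.sqrt q ≤ 1 / 2)
    (hd : 1 ≤ d) (hN : 1 ≤ N) (h : rate M ι e R τ q d N < 2 * R * M) :
    (N : ℝ) ^ (-(1 / 2 : ℝ) + ι) ≤ q ∧ (d : ℝ) ≤ (N : ℝ) ^ (e / 2) := by
  have hN1 : (1 : ℝ) ≤ N := by exact_mod_cast hN
  have hN0 : (0 : ℝ) < N := by linarith
  have hd1 : (1 : ℝ) ≤ d := by exact_mod_cast hd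
  set α : ℝ := 1 / (e - ι / 2) + ι / 8
  have hα : 1 / e ≤ α := by
    have : 1 / e ≤ 1 / (e - ι / 2) := one_div_le_one_div_of_le (by linarith) (by linarith)
    simp only [α]
    linarith
  have hα0 : 0 ≤ α := le_trans (by positivity) hα
  have h1 := (le_max_right _ _).trans_lt h
  have hq32 : q ^ (3 / 2 : ℝ) = q * Real.sqrt q := by
    rw [Real.sqrt_eq_rpow, ← Real.rpow_one_add' hq.le (by norm_num)]
    norm_num
  have key : (d : ℝ) ^ α * (N : ℝ) ^ (-(1 / 2 : ℝ) + ι) ≤ q := by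
    have hpos : 0 < M * R / (τ * q ^ (3 / 2 : ℝ)) := by positivity
    have h2 : M * R / (τ * q ^ (3 / 2 : ℝ)) * ((d : ℝ) ^ α * (N : ℝ) ^ (-(1 / 2 : ℝ) + ι)) ≤
        M * R / (τ * q ^ (3 / 2 : ℝ)) * q := by
      rw [← mul_assoc]
      refine h1.le.trans ?_
      rw [hq32, div_mul_eq_mul_div, le_div_iff₀ (by positivity)]
      have : 2 * R * M * (τ * (q * Real.sqrt q)) = (2 * (R * M * q)) * (τ * Real.sqrt q) := by ring
      rw [this]
      have hRMq : 0 < 2 * (R * M * q) := by positivity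
      nlinarith
    exact le_of_mul_le_mul_left h2 hpos
  constructor
  · refine le_trans ?_ key
    exact le_mul_of_one_le_left (by positivity) (Real.one_le_rpow hd1 hα0)
  · have h3 : (d : ℝ) ^ (1 / e) ≤ (N : ℝ) ^ (1 / 2 : ℝ) := by
      calc (d : ℝ) ^ (1 / e) ≤ (d : ℝ) ^ α := Real.rpow_le_rpow_of_exponent_le hd1 hα
        _ = (d : ℝ) ^ α * (N : ℝ) ^ (-(1 / 2 : ℝ) + ι) * (N : ℝ) ^ (1 / 2 - ι) := by
            rw [mul_assoc, ← Real.rpow_add hN0]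
            have : -(1 / 2 : ℝ) + ι + (1 / 2 - ι) = 0 := by ring
            rw [this, Real.rpow_zero, mul_one]
        _ ≤ 1 * (N : ℝ) ^ (1 / 2 : ℝ) := by
            refine mul_le_mul (key.trans hq1) ?_ (by positivity) zero_le_one
            exact Real.rpow_le_rpow_of_exponent_le hN1 (by linarith)
        _ = _ := one_mul _
    have h4 := Real.rpow_le_rpow (by positivity) h3 (show 0 ≤ e by linarith)
    rw [← Real.rpow_mul (by positivity), ← Real.rpow_mul (by positivity),
      one_div_mul_cancel (by linarith), Real.rpow_one, one_div_mul_eq_div] at h4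
    exact h4

/-- This explains the second term of the rate. Of the power `q ^ (3/2)`, one factor `q` comes from
taking `k` proportional to `q`, so that Chernoff can pay for the net, and `√q` comes from the
truncation level `4 M / √q`. The factor `16` in `k` is what the second inequality needs. -/
theorem mesh_le_rate {ι e R τ q M k : ℝ} {d N : ℕ} (hι : 0 < ι) (he : 2 < e) (hι' : ι < 1 / 4)
    (hR : 0 < R) (hτ : 0 < τ) (hq : 0 < q) (hM : 0 < M) (hτq : τ * Real.sqrt q ≤ 1 / 2)
    (hd : 1 ≤ d) (hN : 1 ≤ N) (hk : 16 * q * (N : ℝ) ^ (1 / 2 - ι) ≤ k) :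
    2 * R / k * M ≤ rate M ι e R τ q d N / 4 ∧
      2 * R / k * (4 * M / Real.sqrt q) ≤ τ * rate M ι e R τ q d N / 2 := by
  have hN1 : (1 : ℝ) ≤ N := by exact_mod_cast hN
  have hN0 : (0 : ℝ) < N := by linarith
  have hd1 : (1 : ℝ) ≤ d := by exact_mod_cast hd
  have hα0 : 0 ≤ 1 / (e - ι / 2) + ι / 8 := by
    have : 0 < e - ι / 2 := by linarith
    positivity
  have hk0 : 0 < k := lt_of_lt_of_le (by positivity) hk
  have hq32 : q ^ (3 / 2 : ℝ) = q * Real.sqrt q := by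
    rw [Real.sqrt_eq_rpow, ← Real.rpow_one_add' hq.le (by norm_num)]
    norm_num
  set r := rate M ι e R τ q d N
  have hr : M * R / (τ * (q * Real.sqrt q)) * (N : ℝ) ^ (-(1 / 2 : ℝ) + ι) ≤ r := by
    refine le_trans ?_ (le_max_right _ _)
    rw [hq32]
    refine mul_le_mul_of_nonneg_right ?_ (by positivity)
    exact le_mul_of_one_le_right (by positivity) (Real.one_le_rpow hd1 hα0)
  have hs : 0 < Real.sqrt q := Real.sqrt_pos.2 hq
  have hNN : (N : ℝ) ^ (1 / 2 - ι) * (N : ℝ) ^ (-(1 / 2 : ℝ) + ι) = 1 := by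
    rw [← Real.rpow_add hN0]
    have : (1 / 2 : ℝ) - ι + (-(1 / 2 : ℝ) + ι) = 0 := by ring
    rw [this, Real.rpow_zero]
  have hkr : 16 * (M * R) ≤ τ * Real.sqrt q * (k * r) := by
    calc 16 * (M * R) = τ * Real.sqrt q * ((16 * q * (N : ℝ) ^ (1 / 2 - ι)) *
          (M * R / (τ * (q * Real.sqrt q)) * (N : ℝ) ^ (-(1 / 2 : ℝ) + ι))) := by
          have : τ * Real.sqrt q * ((16 * q * (N : ℝ) ^ (1 / 2 - ι)) *
            (M * R / (τ * (q * Real.sqrt q)) * (N : ℝ) ^ (-(1 / 2 : ℝ) + ι))) =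
            τ * Real.sqrt q * (16 * q * (M * R / (τ * (q * Real.sqrt q)))) *
              ((N : ℝ) ^ (1 / 2 - ι) * (N : ℝ) ^ (-(1 / 2 : ℝ) + ι)) := by ring
          rw [this, hNN]
          field_simp
      _ ≤ _ := by gcongr
  have hkr0 : 0 ≤ k * r := by
    have : 0 ≤ r := le_trans (by positivity) hr
    positivity
  constructor
  · rw [div_mul_eq_mul_div, div_le_div_iff₀ hk0 (by norm_num)]
    nlinarith
  · have e1 : 2 * R / k * (4 * M / Real.sqrt q) = 8 * (M * R) / (k * Real.sqrt q) := by
      field_simp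
      norm_num
    rw [e1, div_le_div_iff₀ (by positivity) (by norm_num)]
    nlinarith

/-- The exponents match exactly: `1 - 1/(2e)` from the number of blocks plus `-1/2 + 1/(2e) + 2 ι`
from the squared rate is `1/2 + 2 ι`; squaring gives `1 + 4 ι`, and the numerator removes one power
of `N`. -/
theorem multiplier_bound_le {ι e R τ₀ V : ℝ} {n N : ℕ} (hR : 0 < R) (hτ₀ : 0 < τ₀) (hV : 0 ≤ V)
    (he : 2 < e) (hN : 1 ≤ N) (hn : (N : ℝ) ^ (1 - 1 / (2 * e)) / 4 ≤ n) :
    N * V / (n * τ₀ * ((N : ℝ) ^ (-(1 / 4 : ℝ) * (1 - 1 / e) + ι)) ^ 2 / (2 * R)) ^ 2 ≤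
      64 * R ^ 2 * V * (τ₀ ^ (-2 : ℝ) * (N : ℝ) ^ (-(4 * ι))) := by
  have hN0 : (0 : ℝ) < N := by exact_mod_cast hN
  set x : ℝ := (N : ℝ)
  have h1 : x ^ (1 - 1 / (2 * e)) / 4 * τ₀ * (x ^ (-(1 / 4 : ℝ) * (1 - 1 / e) + ι)) ^ 2 / (2 * R) ≤
      n * τ₀ * (x ^ (-(1 / 4 : ℝ) * (1 - 1 / e) + ι)) ^ 2 / (2 * R) := by gcongr
  refine (div_le_div_of_nonneg_left (by positivity) (by positivity)
    (pow_le_pow_left₀ (by positivity) h1 2)).trans (le_of_eq ?_)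
  have e1 : (x ^ (1 - 1 / (2 * e)) / 4 * τ₀ *
      (x ^ (-(1 / 4 : ℝ) * (1 - 1 / e) + ι)) ^ 2 / (2 * R)) ^ 2 =
      τ₀ ^ 2 * x ^ (1 + 4 * ι) / (64 * R ^ 2) := by
    have e2 : (x ^ (1 - 1 / (2 * e)) * (x ^ (-(1 / 4 : ℝ) * (1 - 1 / e) + ι)) ^ 2) ^ 2 =
        x ^ (1 + 4 * ι) := by
      rw [← Real.rpow_natCast (x ^ (-(1 / 4 : ℝ) * (1 - 1 / e) + ι)), ← Real.rpow_mul hN0.le,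
        ← Real.rpow_add hN0, ← Real.rpow_natCast, ← Real.rpow_mul hN0.le]
      congr 1
      push_cast
      field_simp
      ring
    rw [← e2]
    ring
  rw [e1, Real.rpow_add hN0, Real.rpow_one, Real.rpow_neg hN0.le, Real.rpow_neg hτ₀.le,
    Real.rpow_two]
  have : 0 < x ^ (4 * ι) := by positivity
  field_simp

/-! ### Norms of functionals of the input -/

section Final

variable {Ω : Type*} [MeasurableSpace Ω] {μ : Measure Ω} [IsProbabilityMeasure μ] {d : ℕ}
  {η : ℝ} {s : Fin d → ℝ} {W : Source d → Ω → ℝ}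

/-- The trial values are almost surely positive, so the coordinates of the input almost surely do
not vanish. This supplies the nondegenerate functional for `sq_mul_smallBall_le`. -/
theorem IsParetoSource.l2Norm_single_pos (h : IsParetoSource μ η s W) (hη : 2 < η)
    (hs : ∀ i, 0 < s i) {R : ℝ} (hR : 0 < R) (t : ℕ) (i : Fin d) :
    0 < l2Norm (μ.map (input η W t)) (linearFun (Pi.single i R)) := by
  have hm := measurable_input (η := η) h.measurable t
  have hne : ∀ᵐ ω ∂μ, input η W t ω i ≠ 0 := by
    have hp := fun k => (h.hasParetoLaw_trialCoord (by linarith) hs k t i).ae_pos (by linarith)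
      (measurable_trialCoord h.measurable k t i)
    filter_upwards [hp 0, hp 1] with ω h0 h1
    simp only [input]
    split_ifs
    · exact h0.ne'
    · exact neg_ne_zero.2 h1.ne'
  rw [l2Norm_map hm, Real.sqrt_pos]
  have e : ∀ ω, linearFun (Pi.single i R) (input η W t ω) = R * input η W t ω i := fun ω => by
    rw [linearFun, Finset.sum_eq_single i (fun j _ hj => by simp [hj]) (by simp)]
    simp
  refine lt_of_le_of_ne (integral_nonneg fun ω => sq_nonneg _) fun h0 => ?_
  have hz := (integral_eq_zero_iff_of_nonneg (fun ω => sq_nonneg _)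
    (memLp_linearFun (h.memLp_input hη hs t) _).integrable_sq).1 h0.symm
  have hf : ∀ᵐ _ω ∂μ, False := by
    filter_upwards [hz, hne] with ω h1 h2
    simp only [e, Pi.zero_apply] at h1
    exact h2 (by simpa [hR.ne'] using h1)
  exact (ae_iff.1 hf).symm.not_lt (by simp)

theorem l2Norm_neg (π : Measure (Fin d → ℝ)) (δ : Fin d → ℝ) :
    l2Norm π (linearFun (-δ)) = l2Norm π (linearFun δ) := by
  unfold l2Norm linearFun
  simp [Finset.sum_neg_distrib]

/-- Disposes of small samples: the power of `N` decays no faster than `1 / N`, because `4 ι e / (1 +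
e) ≤ 1`, so a constant `C₂ ≥ N` makes the bound trivial. -/
theorem one_le_failureProb {C₁ C₂ ι e τ₀ Q : ℝ} {N : ℕ} (hC₁ : 0 < C₁) (hQ : 0 < Q) (hι : 0 < ι)
    (hι' : ι < 1 / 4) (he : 2 < e) (hN : 1 ≤ N) (hτ₀ : 0 < τ₀) (hτ₁ : τ₀ ≤ 1) (hC₂ : (N : ℝ) ≤ C₂) :
    1 ≤ failureProb C₁ C₂ ι e τ₀ Q N := by
  have hN1 : (1 : ℝ) ≤ N := by exact_mod_cast hN
  have hN0 : (0 : ℝ) < N := by linarith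
  have h1 : 1 ≤ τ₀ ^ (-(2 * e / (1 + e))) :=
    Real.one_le_rpow_of_pos_of_le_one_of_nonpos hτ₀ hτ₁ (by
      rw [neg_nonpos]; positivity)
  have h2 : (N : ℝ)⁻¹ ≤ (N : ℝ) ^ (-(4 * ι * e / (1 + e))) := by
    rw [← Real.rpow_neg_one]
    refine Real.rpow_le_rpow_of_exponent_le hN1 ?_
    rw [neg_le_neg_iff, div_le_one (by linarith)]
    nlinarith
  have h3 : 1 ≤ C₂ * τ₀ ^ (-(2 * e / (1 + e))) * (N : ℝ) ^ (-(4 * ι * e / (1 + e))) := by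
    have hC₂0 : 0 ≤ C₂ := hN0.le.trans hC₂
    calc 1 = (N : ℝ) * 1 * (N : ℝ)⁻¹ := by field_simp
      _ ≤ _ := by gcongr
  unfold failureProb
  have : 0 ≤ C₁ * (N : ℝ) ^ (1 - 2 * ι) * Q * Real.exp (-(N : ℝ) ^ (2 * ι)) := by positivity
  linarith

/-- The claimed polynomial term is `A ^ (e / (1 + e))` with `A = τ₀ ^ (-2) N ^ (-4 ι)`. For a
probability this fractional power is weaker than the bound by `A` that Chebyshev gives. The
exponential term only enters through its sign. -/
theorem le_failureProb {C₁ C₂ C ι e τ₀ Q P : ℝ} {N : ℕ} (hC₁ : 0 < C₁) (hQ : 0 < Q) (hι : 0 < ι)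
    (hι' : ι < 1 / 4) (he : 2 < e) (hN : 1 ≤ N) (hτ₀ : 0 < τ₀) (hτ₁ : τ₀ ≤ 1) (hC : 0 ≤ C)
    (hC₂ : 3 + C ≤ C₂) (hP1 : P ≤ 1)
    (hP : P ≤ 2 / N + C * (τ₀ ^ (-2 : ℝ) * (N : ℝ) ^ (-(4 * ι)))) :
    P ≤ failureProb C₁ C₂ ι e τ₀ Q N := by
  have hN1 : (1 : ℝ) ≤ N := by exact_mod_cast hN
  have hN0 : (0 : ℝ) < N := by linarith
  set A : ℝ := τ₀ ^ (-2 : ℝ) * (N : ℝ) ^ (-(4 * ι)) with hA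
  have hA0 : 0 ≤ A := by positivity
  have hAp : A ^ (e / (1 + e)) = τ₀ ^ (-(2 * e / (1 + e))) * (N : ℝ) ^ (-(4 * ι * e / (1 + e))) := by
    rw [hA, Real.mul_rpow (by positivity) (by positivity), ← Real.rpow_mul hτ₀.le,
      ← Real.rpow_mul hN0.le]
    congr 2 <;> ring
  have h1 : 1 ≤ τ₀ ^ (-(2 * e / (1 + e))) :=
    Real.one_le_rpow_of_pos_of_le_one_of_nonpos hτ₀ hτ₁ (by
      rw [neg_nonpos]; positivity)
  have h2 : (N : ℝ)⁻¹ ≤ (N : ℝ) ^ (-(4 * ι * e / (1 + e))) := by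
    rw [← Real.rpow_neg_one]
    refine Real.rpow_le_rpow_of_exponent_le hN1 ?_
    rw [neg_le_neg_iff, div_le_one (by linarith)]
    nlinarith
  have h3 : 2 / (N : ℝ) ≤ 2 * A ^ (e / (1 + e)) := by
    rw [hAp, div_eq_mul_inv]
    have : 1 * (N : ℝ)⁻¹ ≤ τ₀ ^ (-(2 * e / (1 + e))) * (N : ℝ) ^ (-(4 * ι * e / (1 + e))) := by
      gcongr
    linarith
  have h4 := le_const_mul_rpow_of_le_add hP1 hA0 hC (by positivity) (p := e / (1 + e))
    (by positivity) ((div_le_one (by linarith)).2 (by linarith)) hP h3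
  have h5 : (3 + C) * A ^ (e / (1 + e)) ≤ C₂ * A ^ (e / (1 + e)) := by gcongr
  unfold failureProb
  have : 0 ≤ C₁ * (N : ℝ) ^ (1 - 2 * ι) * Q * Real.exp (-(N : ℝ) ^ (2 * ι)) := by positivity
  rw [hAp, ← mul_assoc] at h5
  rw [hAp] at h4
  linarith

end Final

/-! ### The deviation bound -/

section Deviation

variable {Ω : Type*} [MeasurableSpace Ω] {μ : Measure Ω} [IsProbabilityMeasure μ] {d : ℕ}

/-- The deviation bound for empirical risk minimizers, for given block parameters. -/
theorem measure_l2Norm_gt_le {η η' R τ τ₀ q M r r₀ : ℝ} {s : Fin d → ℝ} {W : Source d → Ω → ℝ}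
    {υ : ℕ → Ω → ℝ} {θ : Fin d → ℝ} (hW : IsParetoSource μ η s W) (hη : 2 < η) (hs : ∀ i, 0 < s i)
    (hυ : IsPolynomialNoise μ η' (input η W) υ) (hη' : 2 < η') (hθ : θ ∈ l1Ball d R)
    (hM0 : 0 < M) (hR : 0 < R) (hτ : 0 < τ) (hq : 0 < q) (hτ₀ : 0 < τ₀) (hτq : τ₀ < τ ^ 2 * q / 8)
    (hM : 2 * tailMoment η * (∑ i, 1 / s i) ^ 2 ≤ M ^ 2)
    (hqs : q = smallBall (μ.map (input η W 1)) (linearClass d R - linearClass d R) (2 * τ))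
    {N a k n : ℕ} (hN : 1 ≤ N) (ha : 0 < a) (hk : 0 < k) (hn : 0 < n) (han : a * n ≤ N)
    (hr₀ : 0 < r₀) (hr₀r : r₀ ≤ r)
    (hr : 2 * R / k * M ≤ r / 4) (hr' : 2 * R / k * (4 * M / Real.sqrt q) ≤ τ * r / 2)
    (had : 4 * d * (2 : ℝ) ^ (-(a : ℝ) / 2) ≤ q / 4) (fhat : Ω → (Fin d → ℝ) → ℝ)
    (hf : ∀ᵐ ω ∂μ, IsEmpiricalRiskMinimizer (linearClass d R) N (fun t => input η W t ω)
      (fun t => response (input η W) υ θ t ω) (fhat ω)) :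
    μ {ω | ¬ l2Norm (μ.map (input η W 1)) (fhat ω - linearFun θ) ≤ r} ≤ ENNReal.ofReal
      (n * (4 * d * (2 : ℝ) ^ (-(a : ℝ) / 2)) + (2 * d + 1) ^ k * Real.exp (-(n * q / 16)) +
        N * (tailMoment η' * (2 * tailMoment η * ∑ i, 1 / s i ^ 2)) /
          (n * τ₀ * r₀ ^ 2 / (2 * R)) ^ 2) := by
  obtain ⟨E, hE, hEb⟩ := hW.exists_event_quadratic_ge hη hs hM0 hR hτ hq hM hqs n ha hk hr hr' had
  have hn0 : (0 : ℝ) < n := by exact_mod_cast hn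
  -- With this level the basic inequality bounds the quadratic sum by `4 R ℓ = 2 n τ₀ r₀ ^ 2`. The
  -- lower bound is at least `n q τ ^ 2 r₀ ^ 2 / 4`, strictly larger because `τ₀ < τ ^ 2 q / 8`.
  set ℓ : ℝ := n * τ₀ * r₀ ^ 2 / (2 * R) with hℓ
  have hℓ0 : 0 < ℓ := by positivity
  set B : Set Ω := {ω | ∃ i, ℓ ≤ |∑ t ∈ Finset.Icc 1 N, υ t ω * input η W t ω i|} with hB
  have hBle := IsPolynomialNoise.measure_exists_le_abs_sum hW hη hs hυ hη' hℓ0 N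
  have hsub : ∀ᵐ ω ∂μ, ω ∈ {ω | ¬ l2Norm (μ.map (input η W 1)) (fhat ω - linearFun θ) ≤ r} →
      ω ∈ E ∪ B := by
    filter_upwards [hf] with ω hω hbad
    by_contra hnot
    have hωE : ω ∉ E := fun h => hnot (Or.inl h)
    have hωB : ∀ i, |∑ t ∈ Finset.Icc 1 N, υ t ω * input η W t ω i| ≤ ℓ := by
      intro i
      by_contra hc
      exact hnot (Or.inr ⟨i, (not_le.1 hc).le⟩)
    obtain ⟨θ', hθ', hθf⟩ := hω.1
    rw [← hθf] at hω
    set δ := θ' - θ with hδ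
    have hδb : δ ∈ l1Ball d (2 * R) := sub_mem_l1Ball hθ' hθ
    have hnorm : r < l2Norm (μ.map (input η W 1)) (linearFun δ) := by
      have h1 : ¬ l2Norm (μ.map (input η W 1)) (fhat ω - linearFun θ) ≤ r := hbad
      rw [← hθf, linearFun_sub] at h1
      exact not_le.1 h1
    set m := l2Norm (μ.map (input η W 1)) (linearFun δ)
    have hθδ : θ' = θ + δ := by rw [hδ, add_sub_cancel]
    rw [hθδ] at hω
    have h1 := hω.sum_sq_le hN hθ hδb (u := fun t => υ t ω) (fun t => rfl) hωB hℓ0.le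
    have h2 := hEb ω hωE δ hδb hnorm.le
    -- Only the last time of each block, `a * (j + 1) ≤ a * n ≤ N`, is kept; the other squares are
    -- discarded.
    have h3 : ∑ j ∈ Finset.range n, linearFun δ (input η W (a * j + a) ω) ^ 2 ≤
        ∑ t ∈ Finset.Icc 1 N, linearFun δ (input η W t ω) ^ 2 := by
      have hinj : Set.InjOn (fun j => a * j + a) (Finset.range n) := by
        intro i _ j _ hij
        have : a * i = a * j := Nat.add_right_cancel hij
        exact Nat.eq_of_mul_eq_mul_left ha this
      rw [← Finset.sum_image (f := fun t => linearFun δ (input η W t ω) ^ 2) hinj]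
      refine Finset.sum_le_sum_of_subset_of_nonneg ?_ fun _ _ _ => sq_nonneg _
      intro t ht
      obtain ⟨j, hj, rfl⟩ := Finset.mem_image.1 ht
      have hj := Finset.mem_range.1 hj
      have : a * (j + 1) ≤ a * n := Nat.mul_le_mul_left a hj
      rw [mul_add, mul_one] at this
      exact Finset.mem_Icc.2 ⟨by omega, this.trans han⟩
    have h4 : 4 * R * ℓ = 2 * n * τ₀ * r₀ ^ 2 := by
      rw [hℓ]; field_simp; norm_num
    have h5 : n * q / 4 * (τ * r₀) ^ 2 ≤ n * q / 4 * (τ * m) ^ 2 := by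
      have : r₀ ≤ m := hr₀r.trans hnorm.le
      gcongr
    have h6 : n * r₀ ^ 2 * τ₀ < n * r₀ ^ 2 * (τ ^ 2 * q / 8) :=
      mul_lt_mul_of_pos_left hτq (by positivity)
    have h7 : n * q / 4 * (τ * r₀) ^ 2 = 2 * (n * r₀ ^ 2 * (τ ^ 2 * q / 8)) := by ring
    linarith
  calc μ {ω | ¬ l2Norm (μ.map (input η W 1)) (fhat ω - linearFun θ) ≤ r}
      ≤ μ (E ∪ B) := measure_mono_ae hsub
    _ = ENNReal.ofReal (μ.real (E ∪ B)) := by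
        rw [measureReal_def, ENNReal.ofReal_toReal (measure_ne_top _ _)]
    _ ≤ _ := ENNReal.ofReal_le_ofReal
        ((measureReal_union_le _ _).trans (add_le_add hE hBle))

/-- The population risk exceeds its value at the true parameter by the squared distance. -/
theorem integral_sq_sub_response_input {η η' : ℝ} {s : Fin d → ℝ} {W : Source d → Ω → ℝ}
    {υ : ℕ → Ω → ℝ} (hW : IsParetoSource μ η s W) (hη : 2 < η) (hs : ∀ i, 0 < s i)
    (hυ : IsPolynomialNoise μ η' (input η W) υ) (hη' : 2 < η') (θ θ' : Fin d → ℝ) (t : ℕ) :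
    ∫ ω, (linearFun θ' (input η W t ω) - response (input η W) υ θ t ω) ^ 2 ∂μ =
      l2Norm (μ.map (input η W t)) (linearFun (θ' - θ)) ^ 2 + ∫ ω, υ t ω ^ 2 ∂μ :=
  integral_sq_sub_response (measurable_input hW.measurable t) (hW.memLp_input hη hs t)
    (hυ.memLp_two hη' t) (hυ.mean_zero t)
    (hυ.indep_input.comp (measurable_pi_apply t) (measurable_pi_apply t)) θ' θ

theorem sum_one_div_sq_le {s : Fin d → ℝ} {c : ℝ} (hc : 0 < c) (h : ∀ i, c ≤ s i) :
    ∑ i, 1 / s i ^ 2 ≤ (∑ i, 1 / s i) / c := by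
  rw [Finset.sum_div]
  refine Finset.sum_le_sum fun i _ => ?_
  rw [div_div]
  have := h i
  have hs : 0 < s i := hc.trans_le this
  rw [sq]
  gcongr

end Deviation

end ParetoRegression

/-! ### The main theorem -/

theorem proposition2 (ι η₃ η₄ K₀ C₆ : ℝ) (hι : 0 < ι)
    (hη₃ : 2 + 2 * ι < η₃) (hη₄ : 2 + 2 * ι < η₄)
    (hι' : ι < (1 - 1 / min η₃ η₄) / 4) (hK₀ : 0 < K₀) (hC₆ : 0 < C₆) :
    ∃ C₉ : ℝ, 0 < C₉ ∧ ∃ C₁ : ℝ, 0 < C₁ ∧ ∀ R : ℝ, 0 < R → ∃ C₂ : ℝ, 0 < C₂ ∧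
      ∀ (d : ℕ) (s : Fin d → ℝ), (∀ i, C₆ ≤ s i) → ∑ i, 1 / s i = K₀ →
      ∀ (Ω : Type*) [MeasurableSpace Ω] (μ : Measure Ω) [IsProbabilityMeasure μ]
        (W : ParetoRegression.Source d → Ω → ℝ) (υ : ℕ → Ω → ℝ) (θstar : Fin d → ℝ)
        (X : ℕ → Ω → Fin d → ℝ) (Y : ℕ → Ω → ℝ)
        (π : Measure (Fin d → ℝ)) (F : Set ((Fin d → ℝ) → ℝ)),
      ParetoRegression.IsParetoSource μ η₃ s W →
      X = ParetoRegression.input η₃ W →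
      ParetoRegression.IsPolynomialNoise μ η₄ X υ →
      θstar ∈ ParetoRegression.l1Ball d R →
      Y = ParetoRegression.response X υ θstar →
      π = μ.map (X 1) →
      F = ParetoRegression.linearClass d R →
      -- the true functional minimizes the population risk
      ParetoRegression.IsPopulationRiskMinimizer μ F (X 1) (Y 1)
          (ParetoRegression.linearFun θstar) ∧
      -- the small-ball condition can be met
      (∃ τ : ℝ, 0 < τ ∧ 0 < ParetoRegression.smallBall π (F - F) (2 * τ)) ∧
      -- the rate
      ∀ (τ τ₀ Q : ℝ), Q = ParetoRegression.smallBall π (F - F) (2 * τ) →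
        0 < τ → 0 < Q → 0 < τ₀ → τ₀ < τ ^ 2 * Q / 8 →
        ∀ (N : ℕ), 1 ≤ N →
        ∀ (fstar : (Fin d → ℝ) → ℝ) (fhat : Ω → (Fin d → ℝ) → ℝ),
          ParetoRegression.IsPopulationRiskMinimizer μ F (X 1) (Y 1) fstar →
          (∀ᵐ ω ∂μ, ParetoRegression.IsEmpiricalRiskMinimizer F N
            (fun t => X t ω) (fun t => Y t ω) (fhat ω)) →
          μ {ω | ¬ ParetoRegression.l2Norm π (fhat ω - fstar) ≤
              ParetoRegression.rate C₉ ι (min η₃ η₄) R τ Q d N} ≤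
            ENNReal.ofReal
              (ParetoRegression.failureProb C₁ C₂ ι (min η₃ η₄) τ₀ Q N) := by
  have h3 : 2 < η₃ := by linarith
  have h4 : 2 < η₄ := by linarith
  set e : ℝ := min η₃ η₄ with he'
  have he : 2 < e := lt_min h3 h4
  have hι4 : ι < 1 / 4 := by
    have : 0 < 1 / e := by positivity
    linarith
  have ht3 := ParetoRegression.tailMoment_pos h3
  have ht4 := ParetoRegression.tailMoment_pos h4
  obtain ⟨N₀, hN₀⟩ := ParetoRegression.exists_block_parameters hι he hι4
  -- `M` bounds the `L²` norm of the `ℓ¹` norm of the input; it serves as `C₉`.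
  set M : ℝ := Real.sqrt (2 * ParetoRegression.tailMoment η₃) * K₀ with hMdef
  have hM0 : 0 < M := by positivity
  have hM2 : 2 * ParetoRegression.tailMoment η₃ * K₀ ^ 2 = M ^ 2 := by
    rw [hMdef, mul_pow, Real.sq_sqrt (by positivity)]
  refine ⟨M, hM0, 1, one_pos, fun R hR => ?_⟩
  set V : ℝ := ParetoRegression.tailMoment η₄ *
    (2 * ParetoRegression.tailMoment η₃ * (K₀ / C₆)) with hV
  have hV0 : 0 < V := by positivity
  -- The summand `N₀` covers samples smaller than `N₀`; the others are the constant of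
  -- `le_failureProb`. The threshold `N₀` depends only on `ι` and `e`.
  refine ⟨3 + 64 * R ^ 2 * V + N₀, by positivity, ?_⟩
  intro d s hs hsum Ω _ μ _ W υ θ X Y π F hW hX hυ hθ hY hπ hF
  subst hX hY hπ hF
  have hs0 : ∀ i, 0 < s i := fun i => hC₆.trans_le (hs i)
  have hXm := ParetoRegression.measurable_input (η := η₃) hW.measurable 1
  have hX2 := hW.memLp_input h3 hs0 1
  have hrisk := fun θ' =>
    ParetoRegression.integral_sq_sub_response_input hW h3 hs0 hυ h4 θ θ' 1
  have hnorm0 : ParetoRegression.l2Norm (μ.map (ParetoRegression.input η₃ W 1))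
      (ParetoRegression.linearFun (θ - θ)) = 0 := by
    simp [ParetoRegression.l2Norm, ParetoRegression.linearFun]
  refine ⟨⟨⟨θ, hθ, rfl⟩, ?_⟩, ParetoRegression.exists_smallBall_pos hXm hX2 hR.le, ?_⟩
  · rintro _ ⟨θ', -, rfl⟩
    rw [hrisk, hrisk, hnorm0]
    have := sq_nonneg (ParetoRegression.l2Norm (μ.map (ParetoRegression.input η₃ W 1))
      (ParetoRegression.linearFun (θ' - θ)))
    linarith
  intro τ τ₀ q hqs hτ hq hτ₀ hτ₀q N hN fstar fhat hstar hhat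
  have hd : 1 ≤ d := by
    rcases Nat.eq_zero_or_pos d with h0 | h0
    · subst h0
      simp at hsum
      linarith
    · exact h0
  have hτq1 : 4 * τ ^ 2 * q ≤ 1 := by
    rw [hqs]
    refine ParetoRegression.sq_mul_smallBall_le hXm hX2 hτ (δ := Pi.single ⟨0, hd⟩ R) ?_
      (hW.l2Norm_single_pos h3 hs0 hR 1 _)
    change ∑ i, |(Pi.single (⟨0, hd⟩ : Fin d) R : Fin d → ℝ) i| ≤ 2 * R
    rw [Finset.sum_eq_single ⟨0, hd⟩ (fun j _ hj => by simp [hj]) (by simp), Pi.single_eq_same,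
      abs_of_pos hR]
    linarith
  have hτq : τ * Real.sqrt q ≤ 1 / 2 := by
    refine le_of_sq_le_sq ?_ (by norm_num)
    rw [mul_pow, Real.sq_sqrt hq.le]
    linarith
  have hq1 : q ≤ 1 := by
    rw [hqs]
    refine (ParetoRegression.smallBall_le hXm (δ := 0) ?_ _).trans measureReal_le_one
    change ∑ _i : Fin d, |(0 : ℝ)| ≤ 2 * R
    simpa using hR.le
  have hτ₀1 : τ₀ ≤ 1 := by linarith
  obtain ⟨⟨θ', hθ', rfl⟩, hmin⟩ := hstar
  -- The excess risk of `θ'` over `θ` is their squared `L²` distance, so any population minimizer is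
  -- at distance zero from the true functional and may be replaced by it.
  have hzero : ParetoRegression.l2Norm (μ.map (ParetoRegression.input η₃ W 1))
      (ParetoRegression.linearFun (θ - θ')) = 0 := by
    have h := hmin _ ⟨θ, hθ, rfl⟩
    rw [hrisk, hrisk, hnorm0] at h
    rw [← ParetoRegression.l2Norm_neg, neg_sub]
    exact pow_eq_zero_iff (two_ne_zero) |>.1 (le_antisymm (by linarith) (sq_nonneg _))
  rcases lt_or_ge N N₀ with hNN | hNN
  · refine prob_le_one.trans ?_
    rw [← ENNReal.ofReal_one]
    refine ENNReal.ofReal_le_ofReal (ParetoRegression.one_le_failureProb one_pos hq hι hι4 he hN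
      hτ₀ hτ₀1 ?_)
    have : (N : ℝ) ≤ N₀ := by exact_mod_cast hNN.le
    have : 0 ≤ 64 * R ^ 2 * V := by positivity
    linarith
  set r := ParetoRegression.rate M ι e R τ q d N with hr
  have hsub : μ {ω | ¬ ParetoRegression.l2Norm (μ.map (ParetoRegression.input η₃ W 1))
      (fhat ω - ParetoRegression.linearFun θ') ≤ r} ≤
      μ {ω | ¬ ParetoRegression.l2Norm (μ.map (ParetoRegression.input η₃ W 1))
      (fhat ω - ParetoRegression.linearFun θ) ≤ r} := by
    refine measure_mono_ae ?_
    filter_upwards [hhat] with ω hω hbad hle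
    obtain ⟨θ'', -, hθ''⟩ := hω.1
    refine hbad (le_trans ?_ hle)
    rw [← hθ'', ParetoRegression.linearFun_sub, ParetoRegression.linearFun_sub]
    refine (ParetoRegression.l2Norm_add_le hXm hX2 _ (θ'' - θ)).trans (le_of_eq ?_)
    rw [sub_sub_sub_cancel_left, hzero, add_zero]
  refine hsub.trans ?_
  have hMs : 2 * ParetoRegression.tailMoment η₃ * (∑ i, 1 / s i) ^ 2 ≤ M ^ 2 := by
    rw [hsum, hM2]
  -- Differences of members of the class have coefficients of size at most `2 R`, hence norm at most
  -- `2 R M`; a rate above this value cannot be violated.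
  rcases le_or_gt (2 * R * M) r with htriv | hnontriv
  · refine le_of_eq_of_le ?_ zero_le
    refine ae_iff.1 ?_
    filter_upwards [hhat] with ω hω
    obtain ⟨θ'', hθb, hθ''⟩ := hω.1
    rw [← hθ'', ParetoRegression.linearFun_sub]
    refine le_trans (ParetoRegression.l2Norm_le_of_abs_le hXm hX2
      ((hW.integral_norm_sq_le h3 hs0 1).2.trans hMs) hM0.le (by positivity)
      (ParetoRegression.abs_apply_le_of_mem_l1Ball (ParetoRegression.sub_mem_l1Ball hθb hθ)))
      htriv
  · obtain ⟨hqN, hdN⟩ := ParetoRegression.rate_lt_imp hι he hι4 hR hτ hq hq1 hM0 hτq hd hN hnontriv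
    obtain ⟨a, k, n, ha, hk, han, hkN, had, hfail, hn⟩ := hN₀ N hNN d q hdN hqN
    obtain ⟨hm1, hm2⟩ := ParetoRegression.mesh_le_rate hι he hι4 hR hτ hq hM0 hτq hd hN hkN
    have hN0 : (0 : ℝ) < N := by exact_mod_cast hN
    have hn0 : 0 < n := by
      have : (0 : ℝ) < n := lt_of_lt_of_le (by positivity) hn
      exact_mod_cast this
    have hdev := ParetoRegression.measure_l2Norm_gt_le hW h3 hs0 hυ h4 hθ hM0 hR hτ hq hτ₀ hτ₀q hMs
      hqs hN ha hk hn0 han (r₀ := (N : ℝ) ^ (-(1 / 4 : ℝ) * (1 - 1 / e) + ι)) (by positivity)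
      (le_max_left _ _) hm1 hm2 had fhat hhat
    set P := μ {ω | ¬ ParetoRegression.l2Norm (μ.map (ParetoRegression.input η₃ W 1))
      (fhat ω - ParetoRegression.linearFun θ) ≤ r} with hP
    have hsq : ∑ i, 1 / s i ^ 2 ≤ K₀ / C₆ := by
      rw [← hsum]
      exact ParetoRegression.sum_one_div_sq_le hC₆ hs
    have hmul : N * (ParetoRegression.tailMoment η₄ * (2 * ParetoRegression.tailMoment η₃ *
        ∑ i, 1 / s i ^ 2)) / (n * τ₀ * ((N : ℝ) ^ (-(1 / 4 : ℝ) * (1 - 1 / e) + ι)) ^ 2 /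
          (2 * R)) ^ 2 ≤ 64 * R ^ 2 * V * (τ₀ ^ (-2 : ℝ) * (N : ℝ) ^ (-(4 * ι))) := by
      refine le_trans ?_ (ParetoRegression.multiplier_bound_le hR hτ₀ hV0.le he hN hn)
      rw [hV]
      gcongr
    have hPtop : P ≠ ⊤ := measure_ne_top _ _
    rw [← ENNReal.ofReal_toReal hPtop]
    refine ENNReal.ofReal_le_ofReal (ParetoRegression.le_failureProb one_pos hq hι hι4 he hN hτ₀
      hτ₀1 (C := 64 * R ^ 2 * V) (by positivity) (by linarith [Nat.cast_nonneg (α := ℝ) N₀])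
      measureReal_le_one ?_)
    refine ENNReal.toReal_le_of_le_ofReal (by positivity) (hdev.trans ?_)
    exact ENNReal.ofReal_le_ofReal (add_le_add hfail hmul)
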